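/- **Theorem (private all-pairs distances, small feedback vertex set).** Let $G=(V,E)$ be a connected undirected graph with $n=|V|$ vertices and public topology, with private edge weights $w\colon E\to[0,\infty)$; two weight functions are neighbouring if $\sum_{e\in E}|w(e)-w'(e)|\le 1$. Write $d(u,v)$ for the shortest path distance in $(G,w)$. Let $S\subseteq V$ be a feedback vertex set of $G$ (i.e. $G\setminus S$ is a forest) that depends only on the topology, for instance the output of a 2-approximation algorithm for minimum feedback vertex set, and let $k=|S|$. Let $\epsilon>0$, $0<\delta<1$, $\epsilon'=\epsilon/3$, and let $\mathrm{Lap}(b)$ be the centred Laplace law with density $\frac1{2b}e^{-|x|/b}$ (the point mass at $0$ if $b=0$). Consider the following algorithm, in which all noise variables are independent and a minimum over the empty set is $+\infty$. 1. *(Forest distances, Sealfon's algorithm.)* Let $N=|V\setminus S|$ and fix a root in each tree of the forest $G\setminus S$. For a subtree $T$ with top vertex $r$ and at least two vertices, let $v^*$ be the vertex whose subtree in $T$ has more than $|T|/2$ vertices while the subtrees $T_c$ of its children $c\in T$ have at most $|T|/2$ vertices. Put $\hat d(v^*,T)=d_{G\setminus S}(r,v^*)+X_{v^*,T}$ and $\hat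 d(c,T)=\hat d(v^*,T)+w(v^*,c)+X_{c,T}$, with $X_{\cdot,T}\sim \mathrm{Lap}(\lceil\log_2 N\rceil/\epsilon')$. Recursively, $\hat d(x,T)=\hat d(c,T)+\hat d(x,T_c)$ if $x\in T_c$ for a child $c$ of $v^*$, and $\hat d(x,T)=\hat d(x,T\setminus\bigcup_cT_c)$ otherwise, with value $0$ when $|T|=1$. For $x,y$ in the same tree $T$ with lowest common ancestor $z$ put $\hat d_F(x,y)=\hat d(x,T)+\hat d(y,T)-2\hat d(z,T)$; for $x,y$ in different trees put $\hat d_F(x,y)=+\infty$. 2. For all ordered pairs $u,v\in S$ put $\hat d(u,v)=d(u,v)+\mathrm{Lap}(2\sqrt2\,k\sqrt{\log(1/\delta)}/\epsilon')$. 3. For each edge $\{p,v\}$ with $p\notin S$, $v\in S$ put $w'(p,v)=w(p,v)+\mathrm{Lap}(1/\epsilon')$. 4. For $u\notin S$, $v\in S$ put $\hat d_0(u,v)=\min_{p\notin S,\ \{p,v\}\in E}\big(\hat d_F(u,p)+w'(p,v)\big)$, and then $\hat d(u,v)=\hat d(v,u)=\min_{p\in S}\big(\hat d_0(u,p)+\hat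 d(p,v)\big)$. 5. For $u,v\notin S$ put $\hat d(u,v)=\min\Big(\hat d_F(u,v),\ \min_{p\in S}\big(\hat d(u,p)+\hat d(p,v)\big)\Big)$. There is an absolute constant $C>0$ such that for all such $G$, $S$, $\epsilon$, $\delta$: * (Privacy) if $\epsilon'\le 8\log(1/\delta)$ (for instance if $\epsilon'\le1$ and $\delta\le 1/2$), the released distances $(\hat d(u,v))_{u,v\in V}$ are $(\epsilon,\delta)$-differentially private with respect to neighbouring weights; * (Accuracy) for all weights $w\ge 0$ and all $\gamma>0$, with probability at least $1-3\gamma$, simultaneously for all $u,v\in V$, $$|\hat d(u,v)-d(u,v)|\le C\Big(\epsilon^{-1}k\log(k/\gamma)\sqrt{\log(1/\delta)}+\epsilon^{-1}\log^{2.5}(n)\,\log(1/\gamma)\Big),$$ where the first term is $0$ if $k=0$. -/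

import Mathlib

open MeasureTheory
open scoped NNReal ENNReal

universe u

namespace FVSRelease

noncomputable section

/-- The centred Laplace distribution `Lap(0, b)`, with density `exp (-|x| / b) / (2 b)`;
for scale `b ≤ 0` (no noise) it is the point mass at `0`. -/
def laplace (b : ℝ) : Measure ℝ :=
  open Classical in
  if 0 < b then
    volume.withDensity (fun x => ENNReal.ofReal (1 / (2 * b) * Real.exp (-|x| / b)))
  else Measure.dirac 0

/-- The shortest path distance with respect to the weights `w`: the minimum of `∑_{e ∈ P} w e`
over all paths `P` from `u` to `v`. (Used only when `u` and `v` are connected.) -/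
def wdist {V : Type u} (G : SimpleGraph V) (w : Sym2 V → ℝ≥0) (u v : V) : ℝ :=
  ⨅ p : G.Path u v, ((p : G.Walk u v).edges.map (fun e => (w e : ℝ))).sum

/-- Two weight functions on the edges of the (public) graph `G` are neighbouring if
`∑_{e ∈ E} |w e - w' e| ≤ 1`. Values of `w` outside of the edge set are irrelevant. -/
def Neighboring {V : Type u} [Fintype V] [DecidableEq V] (G : SimpleGraph V)
    (w w' : Sym2 V → ℝ≥0) : Prop :=
  open Classical in
  ∑ e : Sym2 V with e ∈ G.edgeSet, |(w e : ℝ) - (w' e : ℝ)| ≤ 1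

/-- `(ε, δ)`-differential privacy of a randomized algorithm `A`, given by its output law
`A x` on each input `x`, for the neighbouring relation `adj`. -/
def IsDP {X Y : Type*} [MeasurableSpace Y] (adj : X → X → Prop) (A : X → Measure Y)
    (ε δ : ℝ) : Prop :=
  ∀ x x' : X, adj x x' → ∀ O : Set Y, MeasurableSet O →
    A x O ≤ ENNReal.ofReal (Real.exp ε) * A x' O + ENNReal.ofReal δ

/-- `S` is a feedback vertex set of `G`: the induced graph on the complement is a forest. -/
def IsFeedbackVertexSet {V : Type u} (G : SimpleGraph V) (S : Finset V) : Prop :=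
  (G.induce {v | v ∉ S}).IsAcyclic

/-! ### All-pairs distances on a forest

The recursive rooted-tree mechanism, run on every tree of a forest `H`, followed by the lowest
common ancestor formula. The noise variable `X (T, v)` is the one drawn for the vertex `v`
when the recursion treats the subtree with vertex set `T`. -/

section Forest

variable {W : Type u} [Fintype W] [DecidableEq W]

/-- A root of the tree (connected component) of `x`. -/
def root (H : SimpleGraph W) (x : W) : W := Quot.out (H.connectedComponentMk x)

/-- `v` is an ancestor of `x` (possibly `x` itself) in the rooted forest: it lies on the path
from the root to `x`. -/
def Anc (H : SimpleGraph W) (v x : W) : Prop :=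
  ∀ p : H.Walk (root H x) x, v ∈ p.support

/-- `c` is a child of `v` in the rooted forest. -/
def IsChild (H : SimpleGraph W) (v c : W) : Prop := H.Adj v c ∧ Anc H v c

/-- `z` is the lowest common ancestor of `x` and `y`. -/
def IsLCA (H : SimpleGraph W) (z x y : W) : Prop :=
  Anc H z x ∧ Anc H z y ∧ ∀ z', Anc H z' x → Anc H z' y → Anc H z' z

/-- The lowest common ancestor of two vertices of the same tree. -/
def lca (H : SimpleGraph W) (x y : W) : W := @Classical.epsilon W ⟨x⟩ (fun z => IsLCA H z x y)

/-- The vertex set of the subtree of `T` that hangs at `v`. -/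
def desc (H : SimpleGraph W) (T : Finset W) (v : W) : Finset W :=
  open Classical in T.filter (fun x => Anc H v x)

/-- `v` is the splitting vertex of `T`: its subtree has more than half of the vertices
of `T`, the subtree of each of its children has at most half of them. -/
def IsSplit (H : SimpleGraph W) (T : Finset W) (v : W) : Prop :=
  v ∈ T ∧ T.card < 2 * (desc H T v).card ∧
    ∀ c ∈ T, IsChild H v c → 2 * (desc H T c).card ≤ T.card

/-- The splitting vertex of `T` (it exists and is unique for a nonempty subtree; `r` only serves
as a default value). -/
def splitVertex (H : SimpleGraph W) (T : Finset W) (r : W) : W :=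
  @Classical.epsilon W ⟨r⟩ (fun v => IsSplit H T v)

/-- `rootedDist H w X fuel T r x` is the noisy distance from `r` to `x` in the subtree of `H`
with vertex set `T` and top vertex `r`. Let `v` be the splitting vertex of `T`. The noisy
distance to `v` is `d(r, v) + X (T, v)`, and for each child `c ∈ T` of `v` the noisy distance to
`c` is the one to `v` plus `w (v, c) + X (T, c)`. If `x` lies in the subtree of a child `c`,
recurse into this subtree (with root `c`) and add the noisy distance to `c`; otherwise recurse into
`T` without the subtrees of the children (with root `r`). The argument `fuel` bounds the depth of
the recursion; as `T` shrinks strictly, any value `≥ |T|` gives the same result. -/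
def rootedDist (H : SimpleGraph W) (w : Sym2 W → ℝ≥0) (X : Finset W × W → ℝ) :
    ℕ → Finset W → W → W → ℝ
  | 0, _, _, _ => 0
  | fuel + 1, T, r, x =>
    open Classical in
    if T.card ≤ 1 then 0
    else
      let v := splitVertex H T r
      if h : ∃ c ∈ T, IsChild H v c ∧ Anc H c x then
        let c := h.choose
        wdist H w r v + X (T, v) + (w s(v, c) + X (T, c))
          + rootedDist H w X fuel (desc H T c) c x
      else
        rootedDist H w X fuel
          (T.filter (fun y => ¬ ∃ c ∈ T, IsChild H v c ∧ Anc H c y)) r x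

/-- The noisy distance from the root of the tree of `x` to `x`. -/
def rootDist (H : SimpleGraph W) (w : Sym2 W → ℝ≥0) (X : Finset W × W → ℝ) (x : W) : ℝ :=
  open Classical in
  rootedDist H w X (Fintype.card W) (Finset.univ.filter (fun y => H.Reachable x y)) (root H x) x

/-- The noisy distance between two vertices of a forest, `⊤` in different trees. -/
def forestDist (H : SimpleGraph W) (w : Sym2 W → ℝ≥0) (X : Finset W × W → ℝ) (x y : W) : EReal :=
  open Classical in
  if H.Reachable x y then
    ((rootDist H w X x + rootDist H w X y - 2 * rootDist H w X (lca H x y) : ℝ) : EReal)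
  else ⊤

/-- The noise of the forest mechanism with privacy parameter `ε`: independent Laplace variables
of scale `⌈log₂ |W|⌉ / ε`. -/
def forestNoise (W : Type u) [Fintype W] (ε : ℝ) : Measure (Finset W × W → ℝ) :=
  Measure.pi (fun _ => laplace ((Nat.clog 2 (Fintype.card W) : ℝ) / ε))

end Forest

/-! ### The release algorithm for a graph with feedback vertex set `S` -/

section Algorithm

variable {V : Type u} [Fintype V] [DecidableEq V]

/-- The noise used by the algorithm: for the forest `G ∖ S`, for the ordered pairs of vertices of
`S`, and for the edges between `S` and `V ∖ S`. -/
abbrev Noise (S : Finset V) : Type u :=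
  (Finset {v // v ∉ S} × {v // v ∉ S} → ℝ) × (V × V → ℝ) × (Sym2 V → ℝ)

/-- All noise variables are independent. With `ε' = ε / 3` and `k = |S|`: the forest mechanism has
privacy parameter `ε'`, the pairs in `S` have scale `2 √2 k √(log (1 / δ)) / ε'`, and the edges
between `S` and `V ∖ S` have scale `1 / ε'`. -/
def noiseLaw (S : Finset V) (ε δ : ℝ) : Measure (Noise S) :=
  (forestNoise {v // v ∉ S} (ε / 3)).prod
    ((Measure.pi (fun _ : V × V =>
        laplace (2 * √2 * (S.card : ℝ) * √(Real.log (1 / δ)) / (ε / 3)))).prod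
      (Measure.pi (fun _ : Sym2 V => laplace (1 / (ε / 3)))))

variable (G : SimpleGraph V) (S : Finset V) (w : Sym2 V → ℝ≥0) (X : Noise S)

/-- Noisy distances in the forest `G ∖ S`. -/
def treeStep (u v : {v // v ∉ S}) : EReal :=
  forestDist (G.induce {v | v ∉ S}) (fun e => w (e.map Subtype.val)) X.1 u v

/-- Noisy distances in `G` between two vertices of `S`. -/
def innerStep (u v : V) : ℝ := wdist G w u v + X.2.1 (u, v)

/-- Noisy weight of an edge between `S` and `V ∖ S`. -/
def noisyWeight (p v : V) : ℝ := (w s(p, v) : ℝ) + X.2.2 s(p, v)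

/-- Paths from `u ∉ S` to `v ∈ S` with no further vertex in `S`: minimum over the neighbours
`p ∉ S` of `v`. -/
def lastStep (u : {v // v ∉ S}) (v : V) : EReal :=
  ⨅ p : {p : {v // v ∉ S} // G.Adj p v},
    treeStep G S w X u p + (noisyWeight S w X p v : EReal)

/-- Paths from `u ∉ S` to `v ∈ S` through a first vertex `p ∈ S`. -/
def crossStep (u : {v // v ∉ S}) (v : V) : EReal :=
  ⨅ p : {p // p ∈ S}, lastStep G S w X u p + (innerStep G S w X p v : EReal)

/-- Pairs `u, v ∉ S`: the better of the forest distance and of the connections through a vertex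
of `S`. -/
def outerStep (u v : {v // v ∉ S}) : EReal :=
  min (treeStep G S w X u v) (⨅ p : {p // p ∈ S}, crossStep G S w X u p + crossStep G S w X v p)

/-- The distances released on weights `w` and noise `X`. -/
def releasedDist (u v : V) : EReal :=
  if hu : u ∈ S then
    if hv : v ∈ S then (innerStep G S w X u v : EReal) else crossStep G S w X ⟨v, hv⟩ u
  else
    if hv : v ∈ S then crossStep G S w X ⟨u, hu⟩ v else outerStep G S w X ⟨u, hu⟩ ⟨v, hv⟩

/-- The output law of the algorithm with privacy parameters `ε, δ` on weights `w`. -/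
def releaseLaw (ε δ : ℝ) : Measure (V → V → EReal) :=
  (noiseLaw S ε δ).map (fun X => releasedDist G S w X)

end Algorithm

end

end FVSRelease

/-!
Privacy. Releasing on weights `w` amounts to post-processing noise that has been shifted by the
exact values it perturbs, so three independent Laplace mechanisms have to be private. In the forest
recursion, the subtrees of one level are disjoint, and within a subtree the path to the splitting
vertex shares no edge with the edges to its children. Hence every level has `ℓ¹`-sensitivity at
most `1`, and there are at most `⌈log₂ N⌉` levels, since each step halves the subtrees. The weights
of the edges have `ℓ¹`-sensitivity `1`. Each of the `k²` distances inside `S` changes by at most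
`1`, so its privacy loss is bounded by some `c` and has mean at most `c² / 2`; the total loss is
then controlled by subgaussian concentration (advanced composition).

Accuracy. A distance from the root of a tree is perturbed by at most `2 ⌈log₂ N⌉` Laplace variables,
and an exponential moment with a union bound shows that each of the three kinds of noise is small
with probability at least `1 - γ`. When the noise is small, the triangle inequality bounds the
released distances from below, and cutting a shortest path at its first vertex in `S` bounds them
from above.
-/

namespace FVSRelease

open SimpleGraph

section WalkWeight

variable {V : Type*} {G : SimpleGraph V} {u v x : V}

/-- The total weight of the edges of a walk, counted with multiplicity. -/
noncomputable def walkWeight (w : Sym2 V → ℝ≥0) (p : G.Walk u v) : ℝ :=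
  (p.edges.map (fun e => (w e : ℝ))).sum

@[simp]
lemma walkWeight_nil (w : Sym2 V → ℝ≥0) : walkWeight w (Walk.nil : G.Walk u u) = 0 := by
  simp [walkWeight]

@[simp]
lemma walkWeight_cons (w : Sym2 V → ℝ≥0) (h : G.Adj u v) (p : G.Walk v x) :
    walkWeight w (Walk.cons h p) = w s(u, v) + walkWeight w p := by
  simp [walkWeight]

@[simp]
lemma walkWeight_append (w : Sym2 V → ℝ≥0) (p : G.Walk u v) (q : G.Walk v x) :
    walkWeight w (p.append q) = walkWeight w p + walkWeight w q := by
  simp [walkWeight]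

@[simp]
lemma walkWeight_reverse (w : Sym2 V → ℝ≥0) (p : G.Walk u v) :
    walkWeight w p.reverse = walkWeight w p := by
  simp [walkWeight]

lemma walkWeight_map {W : Type*} {H : SimpleGraph W} (w : Sym2 V → ℝ≥0) (f : H →g G) {a b : W}
    (p : H.Walk a b) : walkWeight w (p.map f) = walkWeight (fun e => w (e.map f)) p := by
  simp [walkWeight, Function.comp_def]

lemma walkWeight_nonneg (w : Sym2 V → ℝ≥0) (p : G.Walk u v) : 0 ≤ walkWeight w p := by
  induction p with
  | nil => simp
  | cons h p ih => rw [walkWeight_cons]; positivity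

lemma walkWeight_bypass_le [DecidableEq V] (w : Sym2 V → ℝ≥0) (p : G.Walk u v) :
    walkWeight w p.bypass ≤ walkWeight w p :=
  (p.edges_bypass_sublist_edges.map _).sum_le_sum fun _ h => by
    obtain ⟨e, -, rfl⟩ := List.mem_map.1 h
    exact (w e).coe_nonneg

lemma abs_walkWeight_sub_le [DecidableEq V] (w w' : Sym2 V → ℝ≥0) {p : G.Walk u v}
    (hp : p.IsTrail) :
    |walkWeight w p - walkWeight w' p| ≤ ∑ e ∈ p.edges.toFinset, |(w e : ℝ) - w' e| := by
  rw [walkWeight, walkWeight, ← List.sum_toFinset _ hp.edges_nodup,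
    ← List.sum_toFinset _ hp.edges_nodup, ← Finset.sum_sub_distrib]
  exact Finset.abs_sum_le_sum_abs _ _

lemma walkWeight_eq_or_split {P : V → Prop} (w : Sym2 V → ℝ≥0) (p : G.Walk u v) (hu : P u) :
    (∃ hv : P v, ∃ q : (G.induce {x | P x}).Walk ⟨u, hu⟩ ⟨v, hv⟩,
      walkWeight w p = walkWeight (fun e => w (e.map Subtype.val)) q) ∨
    ∃ y : {x // P x}, ∃ z, ¬ P z ∧ G.Adj y z ∧
      ∃ q : (G.induce {x | P x}).Walk ⟨u, hu⟩ y, ∃ r : G.Walk z v,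
        walkWeight w p
          = walkWeight (fun e => w (e.map Subtype.val)) q + w s((y : V), z) + walkWeight w r := by
  induction p with
  | nil => exact Or.inl ⟨hu, Walk.nil, by simp⟩
  | @cons u u' v h p ih =>
    by_cases hu' : P u'
    · have hadj : (G.induce {x | P x}).Adj ⟨u, hu⟩ ⟨u', hu'⟩ := h
      rcases ih hu' with ⟨hv, q, hq⟩ | ⟨y, z, hz, hyz, q, r, hqr⟩
      · exact Or.inl ⟨hv, Walk.cons hadj q, by rw [walkWeight_cons, walkWeight_cons, hq]; rfl⟩
      · exact Or.inr ⟨y, z, hz, hyz, Walk.cons hadj q, r, by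
          rw [walkWeight_cons, walkWeight_cons, hqr, ← add_assoc, ← add_assoc]; rfl⟩
    · exact Or.inr ⟨⟨u, hu⟩, u', hu', h, Walk.nil, p, by simp⟩

end WalkWeight

section Distance

variable {V : Type*} {G : SimpleGraph V} {u v x : V}

lemma wdist_nonneg (w : Sym2 V → ℝ≥0) (u v : V) : 0 ≤ wdist G w u v :=
  Real.iInf_nonneg fun p => walkWeight_nonneg w p.1

lemma wdist_le_walkWeight (w : Sym2 V → ℝ≥0) (p : G.Walk u v) :
    wdist G w u v ≤ walkWeight w p := by
  classical
  have hbdd : BddBelow (Set.range fun q : G.Path u v => walkWeight w q.1) :=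
    ⟨0, Set.forall_mem_range.2 fun q => walkWeight_nonneg w q.1⟩
  exact (ciInf_le hbdd p.toPath).trans (walkWeight_bypass_le w p)

lemma wdist_le_walkWeight_induce {P : V → Prop} (w : Sym2 V → ℝ≥0) {u v : {x // P x}}
    (p : (G.induce {x | P x}).Walk u v) :
    wdist G w u v ≤ walkWeight (fun e => w (e.map Subtype.val)) p := by
  have h := wdist_le_walkWeight w (p.map (Embedding.induce {x | P x}).toHom)
  rwa [walkWeight_map] at h

lemma wdist_self (w : Sym2 V → ℝ≥0) (u : V) : wdist G w u u = 0 :=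
  ((wdist_le_walkWeight w Walk.nil).trans_eq (walkWeight_nil w)).antisymm (wdist_nonneg w u u)

lemma wdist_zero (u v : V) : wdist G 0 u v = 0 := by
  simp [wdist]

lemma wdist_le_of_adj (w : Sym2 V → ℝ≥0) (h : G.Adj u v) : wdist G w u v ≤ w s(u, v) := by
  simpa using wdist_le_walkWeight w h.toWalk

lemma wdist_eq_walkWeight (hG : G.IsAcyclic) (w : Sym2 V → ℝ≥0) {p : G.Walk u v} (hp : p.IsPath) :
    wdist G w u v = walkWeight w p := by
  have : Nonempty (G.Path u v) := ⟨⟨p, hp⟩⟩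
  have hconst (q : G.Path u v) : walkWeight w q.1 = walkWeight w p :=
    congrArg (fun q : G.Path u v => walkWeight w q.1) ((hG.subsingleton_path u v).elim q ⟨p, hp⟩)
  exact (iInf_congr hconst).trans ciInf_const

lemma wdist_eq_of_adj (hG : G.IsAcyclic) (w : Sym2 V → ℝ≥0) (h : G.Adj u v) :
    wdist G w u v = w s(u, v) := by
  simpa using wdist_eq_walkWeight hG w h.isPath_toWalk

lemma wdist_comm (w : Sym2 V → ℝ≥0) (u v : V) : wdist G w u v = wdist G w v u := by
  let e : G.Path u v ≃ G.Path v u :=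
    ⟨Path.reverse, Path.reverse, fun p => Subtype.ext p.1.reverse_reverse,
      fun p => Subtype.ext p.1.reverse_reverse⟩
  exact e.iInf_congr fun p => walkWeight_reverse w p.1

variable [Finite V]

lemma exists_isPath_walkWeight_eq_wdist (w : Sym2 V → ℝ≥0) (h : G.Reachable u v) :
    ∃ p : G.Walk u v, p.IsPath ∧ walkWeight w p = wdist G w u v := by
  classical
  have := Fintype.ofFinite V
  have : Nonempty (G.Path u v) := ⟨h.some.toPath⟩
  obtain ⟨p, hp⟩ := exists_eq_ciInf_of_finite (f := fun p : G.Path u v => walkWeight w p.1)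
  exact ⟨p.1, p.2, hp⟩

lemma wdist_triangle (w : Sym2 V → ℝ≥0) (huv : G.Reachable u v) (hvx : G.Reachable v x) :
    wdist G w u x ≤ wdist G w u v + wdist G w v x := by
  obtain ⟨p, -, hp⟩ := exists_isPath_walkWeight_eq_wdist w huv
  obtain ⟨q, -, hq⟩ := exists_isPath_walkWeight_eq_wdist w hvx
  rw [← hp, ← hq, ← walkWeight_append]
  exact wdist_le_walkWeight w _

lemma wdist_eq_add_of_forall_mem_support (w : Sym2 V → ℝ≥0) (hux : G.Reachable u x)
    (hv : ∀ p : G.Walk u x, v ∈ p.support) :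
    wdist G w u x = wdist G w u v + wdist G w v x := by
  classical
  obtain ⟨p, -, hp⟩ := exists_isPath_walkWeight_eq_wdist w hux
  let q := p.takeUntil v (hv p)
  let r := p.dropUntil v (hv p)
  refine (wdist_triangle w ⟨q⟩ ⟨r⟩).antisymm ?_
  calc wdist G w u v + wdist G w v x
      ≤ walkWeight w q + walkWeight w r :=
        add_le_add (wdist_le_walkWeight w q) (wdist_le_walkWeight w r)
    _ = wdist G w u x := by rw [← walkWeight_append, p.take_spec, hp]

end Distance

section WeightChange

variable {V : Type*} {G : SimpleGraph V} {u v : V}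

open Classical in
/-- The total change, from `w` to `w'`, of the weights of the edges of `G` inside `T`. -/
noncomputable def weightChange (G : SimpleGraph V) (w w' : Sym2 V → ℝ≥0) (T : Finset V) : ℝ :=
  ∑ e ∈ T.sym2 with e ∈ G.edgeSet, |(w e : ℝ) - w' e|

lemma weightChange_nonneg (w w' : Sym2 V → ℝ≥0) (T : Finset V) : 0 ≤ weightChange G w w' T :=
  Finset.sum_nonneg fun _ _ => abs_nonneg _

lemma weightChange_comm (w w' : Sym2 V → ℝ≥0) (T : Finset V) :
    weightChange G w w' T = weightChange G w' w T :=
  Finset.sum_congr rfl fun _ _ => abs_sub_comm _ _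

lemma sum_abs_sub_le_weightChange {w w' : Sym2 V → ℝ≥0} {T : Finset V} {E : Finset (Sym2 V)}
    (hE : ∀ e ∈ E, e ∈ G.edgeSet ∧ ∀ x ∈ e, x ∈ T) :
    ∑ e ∈ E, |(w e : ℝ) - w' e| ≤ weightChange G w w' T := by
  classical
  exact Finset.sum_le_sum_of_subset_of_nonneg
    (fun e he => Finset.mem_filter.2 ⟨Finset.mem_sym2_iff.2 (hE e he).2, (hE e he).1⟩)
    fun _ _ _ => abs_nonneg _

/-- A loopless edge lies inside at most one of several disjoint vertex sets. -/
lemma sum_weightChange_le {ι : Type*} (w w' : Sym2 V → ℝ≥0) {s : Finset ι} {f : ι → Finset V}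
    {T : Finset V} (hf : ∀ i ∈ s, f i ⊆ T) (hdisj : (s : Set ι).PairwiseDisjoint f) :
    ∑ i ∈ s, weightChange G w w' (f i) ≤ weightChange G w w' T := by
  classical
  let E (i : ι) : Finset (Sym2 V) := (f i).sym2.filter (· ∈ G.edgeSet)
  have hE : (s : Set ι).PairwiseDisjoint E := fun i hi j hj hij =>
    Finset.disjoint_left.2 fun e hei hej => by
      have hx := e.out_fst_mem
      exact Finset.disjoint_left.1 (hdisj hi hj hij)
        (Finset.mem_sym2_iff.1 (Finset.mem_filter.1 hei).1 _ hx)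
        (Finset.mem_sym2_iff.1 (Finset.mem_filter.1 hej).1 _ hx)
  calc ∑ i ∈ s, weightChange G w w' (f i) = ∑ e ∈ s.biUnion E, |(w e : ℝ) - w' e| := by
        rw [Finset.sum_biUnion hE]; simp only [weightChange, E]
    _ ≤ weightChange G w w' T := sum_abs_sub_le_weightChange fun e he => by
        obtain ⟨i, hi, hei⟩ := Finset.mem_biUnion.1 he
        obtain ⟨hei, heG⟩ := Finset.mem_filter.1 hei
        exact ⟨heG, fun x hx => hf i hi (Finset.mem_sym2_iff.1 hei x hx)⟩

lemma abs_wdist_sub_le [Fintype V] (w w' : Sym2 V → ℝ≥0) (h : G.Reachable u v) :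
    |wdist G w u v - wdist G w' u v| ≤ weightChange G w w' Finset.univ := by
  classical
  have wdist_le (w w' : Sym2 V → ℝ≥0) :
      wdist G w u v ≤ wdist G w' u v + weightChange G w w' Finset.univ := by
    obtain ⟨p, hp, hpw⟩ := exists_isPath_walkWeight_eq_wdist w' h
    have hsub := (abs_walkWeight_sub_le w w' hp.isTrail).trans
      (sum_abs_sub_le_weightChange (G := G) (T := Finset.univ) fun e he =>
        ⟨p.edges_subset_edgeSet (List.mem_toFinset.1 he), fun _ _ => Finset.mem_univ _⟩)
    linarith [wdist_le_walkWeight w p, (abs_le.1 hsub).2]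
  have hw := wdist_le w w'
  have hw' := wdist_le w' w
  rw [weightChange_comm] at hw'
  exact abs_sub_le_iff.2 ⟨by linarith, by linarith⟩

lemma Neighboring.weightChange_le_one [Fintype V] [DecidableEq V] {w w' : Sym2 V → ℝ≥0}
    (h : Neighboring G w w') : weightChange G w w' Finset.univ ≤ 1 := by
  simpa [weightChange, Neighboring] using h

lemma weightChange_induce_le [Fintype V] (w w' : Sym2 V → ℝ≥0) (s : Set V) (T : Finset s) :
    weightChange (G.induce s) (fun e => w (e.map Subtype.val)) (fun e => w' (e.map Subtype.val)) T
      ≤ weightChange G w w' Finset.univ := by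
  classical
  have hinj : Function.Injective (Sym2.map (Subtype.val : s → V)) :=
    Sym2.map.injective Subtype.val_injective
  rw [weightChange, ← Finset.sum_image (f := fun e => |(w e : ℝ) - w' e|)
    (g := Sym2.map Subtype.val) hinj.injOn]
  refine sum_abs_sub_le_weightChange fun e he => ⟨?_, fun _ _ => Finset.mem_univ _⟩
  obtain ⟨⟨x, y⟩, hxy, rfl⟩ := Finset.mem_image.1 he
  exact (Finset.mem_filter.1 hxy).2

end WeightChange

section Ancestor

variable {W : Type*} {H : SimpleGraph W} {r v x y z : W}

lemma reachable_root (H : SimpleGraph W) (x : W) : H.Reachable (root H x) x :=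
  ConnectedComponent.exact (Quot.out_eq _)

lemma root_eq_of_reachable (h : H.Reachable x y) : root H x = root H y :=
  congrArg Quot.out (ConnectedComponent.sound h)

namespace Anc

lemma refl (H : SimpleGraph W) (x : W) : Anc H x x := fun p => p.end_mem_support

lemma root (H : SimpleGraph W) (x : W) : Anc H (root H x) x := fun p => p.start_mem_support

lemma reachable (h : Anc H v x) : H.Reachable v x := by
  classical
  exact ⟨(reachable_root H x).some.dropUntil v (h _)⟩

lemma mem_support (h : Anc H v x) (hy : H.Reachable x y) (p : H.Walk (FVSRelease.root H y) x) :
    v ∈ p.support := by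
  have heq := root_eq_of_reachable hy
  revert p
  rw [← heq]
  exact h

lemma trans (hxy : Anc H x y) (hyz : Anc H y z) : Anc H x z := by
  classical
  intro p
  exact p.support_takeUntil_subset_support (hyz p) (hxy.mem_support hyz.reachable _)

lemma antisymm (hxy : Anc H x y) (hyx : Anc H y x) : x = y := by
  classical
  obtain ⟨p, hp⟩ := (reachable_root H y).exists_isPath
  by_contra hne
  exact p.endpoint_notMem_support_takeUntil hp (hxy p) (Ne.symm hne)
    (hyx.mem_support hxy.reachable _)

lemma of_mem_support_append (h : Anc H v z) {p : H.Walk (FVSRelease.root H z) y} {q : H.Walk y z}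
    (hpq : (p.append q).IsPath) (hv : v ∈ p.support) : Anc H v y := by
  intro p'
  have heq := root_eq_of_reachable ⟨q⟩
  revert p'
  rw [heq]
  intro p'
  rcases (Walk.mem_support_append_iff ..).1 (h (p'.append q)) with hp' | hq
  · exact hp'
  · by_cases hvy : v = y
    · exact hvy ▸ p'.end_mem_support
    · exact absurd rfl (hpq.ne_of_mem_support_of_append hvy hv hq)

lemma total (hx : Anc H x z) (hy : Anc H y z) : Anc H x y ∨ Anc H y x := by
  classical
  obtain ⟨p, hp⟩ := (reachable_root H z).exists_isPath
  have hsplit := p.take_spec (hy p)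
  rcases (Walk.mem_support_append_iff ..).1 (hsplit.symm ▸ hx p) with hxt | hxd
  · exact Or.inl (hx.of_mem_support_append (hsplit.symm ▸ hp) hxt)
  · refine Or.inr (hy.of_mem_support_append
      (p := (p.takeUntil y (hy p)).append ((p.dropUntil y (hy p)).takeUntil x hxd))
      (q := (p.dropUntil y (hy p)).dropUntil x hxd) ?_
      ((Walk.mem_support_append_iff ..).2 (Or.inl (Walk.end_mem_support _))))
    rwa [← Walk.append_assoc, Walk.take_spec, Walk.take_spec]

lemma mem_support_of_anc (hrv : Anc H r v) (hvx : Anc H v x) (p : H.Walk r x) : v ∈ p.support := by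
  classical
  obtain ⟨q, hq⟩ := (reachable_root H r).exists_isPath
  have heq := root_eq_of_reachable (hrv.trans hvx).reachable
  rcases (Walk.mem_support_append_iff ..).1 (hvx.mem_support ⟨p.reverse⟩ (q.append p))
    with hvq | hvp
  · by_contra hvp
    have hne : v ≠ r := fun h => hvp (h ▸ p.start_mem_support)
    exact q.endpoint_notMem_support_takeUntil hq hvq hne.symm
      (hrv.mem_support hrv.reachable.symm _)
  · exact hvp

end Anc

lemma wdist_eq_add_of_anc [Finite W] (w : Sym2 W → ℝ≥0) (hrv : Anc H r v) (hvx : Anc H v x) :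
    wdist H w r x = wdist H w r v + wdist H w v x :=
  wdist_eq_add_of_forall_mem_support w (hrv.trans hvx).reachable (hrv.mem_support_of_anc hvx)

namespace IsChild

variable {c c' : W}

lemma not_anc (h : IsChild H v c) : ¬ Anc H c v := fun hcv => h.1.ne (h.2.antisymm hcv)

lemma eq_or_anc (h : IsChild H v c) (hx : Anc H x c) : x = c ∨ Anc H x v := by
  refine or_iff_not_imp_left.2 fun hne p => ?_
  have hmem := hx.mem_support h.2.reachable.symm (p.concat h.1)
  rw [Walk.support_concat] at hmem
  simpa [hne] using hmem

lemma eq_of_anc (h : IsChild H v c) (h' : IsChild H v c') (hx : Anc H c x) (hx' : Anc H c' x) :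
    c = c' := by
  rcases hx.total hx' with hcc | hcc
  · exact (h'.eq_or_anc hcc).resolve_right h.not_anc
  · exact ((h.eq_or_anc hcc).resolve_right h'.not_anc).symm

end IsChild

lemma exists_isLCA [Finite W] (h : H.Reachable x y) : ∃ z, IsLCA H z x y := by
  let Common := {z : W // Anc H z x ∧ Anc H z y}
  have : Nonempty Common := ⟨⟨root H x, .root H x, root_eq_of_reachable h ▸ .root H y⟩⟩
  have : IsTrans W (Anc H) := ⟨fun _ _ _ => Anc.trans⟩
  have hdir : Directed (Anc H) (Subtype.val : Common → W) := fun a b => by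
    rcases a.2.1.total b.2.1 with hab | hba
    · exact ⟨b, hab, Anc.refl H _⟩
    · exact ⟨a, Anc.refl H _, hba⟩
  obtain ⟨z, hz⟩ := hdir.finite_le (r := Anc H) id
  exact ⟨z, z.2.1, z.2.2, fun z' hx hy => hz ⟨z', hx, hy⟩⟩

lemma isLCA_lca [Finite W] (h : H.Reachable x y) : IsLCA H (lca H x y) x y :=
  Classical.epsilon_spec (exists_isLCA h)

section Forest

lemma anc_of_mem_support (hH : H.IsAcyclic) {p : H.Walk (root H x) x} (hp : p.IsPath)
    (hv : v ∈ p.support) : Anc H v x := by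
  classical
  intro q
  have hqp : q.bypass = p :=
    congrArg Subtype.val ((hH.subsingleton_path _ _).elim q.toPath ⟨p, hp⟩)
  exact q.support_bypass_subset_support (hqp.symm ▸ hv)

lemma mem_support_iff_of_anc (hH : H.IsAcyclic) (hrx : Anc H r x) {p : H.Walk r x}
    (hp : p.IsPath) : v ∈ p.support ↔ Anc H r v ∧ Anc H v x := by
  classical
  refine ⟨fun hv => ?_, fun h => h.1.mem_support_of_anc h.2 p⟩
  obtain ⟨P, hP⟩ := (reachable_root H x).exists_isPath
  have hdrop : P.dropUntil r (hrx P) = p := congrArg Subtype.val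
    ((hH.subsingleton_path r x).elim ⟨_, hP.dropUntil (hrx P)⟩ ⟨p, hp⟩)
  rw [← hdrop] at hv
  have hvx : Anc H v x := anc_of_mem_support hH hP (P.support_dropUntil_subset_support _ hv)
  refine ⟨(hrx.total hvx).elim id fun hvr => ?_, hvx⟩
  obtain rfl : v = r := by
    by_contra hne
    rw [← P.take_spec (hrx P)] at hP
    exact hP.ne_of_mem_support_of_append hne (hvr.mem_support hrx.reachable _) hv rfl
  exact Anc.refl H v

lemma exists_isChild_anc (hH : H.IsAcyclic) (hvx : Anc H v x) (hne : v ≠ x) :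
    ∃ c, IsChild H v c ∧ Anc H c x := by
  obtain ⟨p, hp⟩ := hvx.reachable.exists_isPath
  cases p with
  | nil => exact absurd rfl hne
  | @cons _ c _ h q =>
    obtain ⟨hvc, hcx⟩ := (mem_support_iff_of_anc hH hvx hp).1
      (List.mem_cons_of_mem _ q.start_mem_support)
    exact ⟨c, ⟨h, hvc⟩, hcx⟩

lemma isPath_append {p : H.Walk x y} {q : H.Walk y z} (hp : p.IsPath) (hq : q.IsPath)
    (hpq : ∀ a ∈ p.support, a ∈ q.support → a = y) : (p.append q).IsPath := by
  rw [Walk.isPath_def, Walk.support_append, List.nodup_append']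
  refine ⟨hp.support_nodup, hq.support_nodup.tail, fun a hap haq => ?_⟩
  obtain rfl := hpq a hap (List.mem_of_mem_tail haq)
  have hnodup := hq.support_nodup
  rw [← q.cons_tail_support, List.nodup_cons] at hnodup
  exact hnodup.1 haq

lemma wdist_eq_of_isLCA [Finite W] (hH : H.IsAcyclic) (w : Sym2 W → ℝ≥0) (hz : IsLCA H z x y) :
    wdist H w x y
      = wdist H w (root H x) x + wdist H w (root H y) y - 2 * wdist H w (root H z) z := by
  obtain ⟨hzx, hzy, hmax⟩ := hz
  obtain ⟨p, hp⟩ := hzx.reachable.exists_isPath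
  obtain ⟨q, hq⟩ := hzy.reachable.exists_isPath
  have hpath : (p.reverse.append q).IsPath := isPath_append hp.reverse hq fun a hap haq => by
    rw [Walk.support_reverse, List.mem_reverse, mem_support_iff_of_anc hH hzx hp] at hap
    rw [mem_support_iff_of_anc hH hzy hq] at haq
    exact (hmax a hap.2 haq.2).antisymm hap.1
  have hxy : wdist H w x y = wdist H w z x + wdist H w z y := by
    rw [wdist_eq_walkWeight hH w hpath, walkWeight_append, walkWeight_reverse,
      wdist_eq_walkWeight hH w hp, wdist_eq_walkWeight hH w hq]
  have hx := wdist_eq_add_of_anc w (Anc.root H z) hzx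
  have hy := wdist_eq_add_of_anc w (Anc.root H z) hzy
  rw [← root_eq_of_reachable hzx.reachable, ← root_eq_of_reachable hzy.reachable]
  linarith

end Forest

end Ancestor

section Decomposition

variable {W : Type*} {H : SimpleGraph W} {T : Finset W} {r v x c : W}

/-- `T` is the vertex set of a subtree of the rooted forest `H` with top vertex `r`. -/
structure IsSubtree (H : SimpleGraph W) (T : Finset W) (r : W) : Prop where
  mem : r ∈ T
  anc : ∀ x ∈ T, Anc H r x
  between : ∀ x ∈ T, ∀ y, Anc H r y → Anc H y x → y ∈ T

open Classical in
/-- The part of `T` that remains when the subtrees of the children of `v` are removed. -/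
noncomputable def trunk (H : SimpleGraph W) (T : Finset W) (v : W) : Finset W :=
  T.filter fun y => ¬ ∃ c ∈ T, IsChild H v c ∧ Anc H c y

lemma mem_desc : x ∈ desc H T v ↔ x ∈ T ∧ Anc H v x := by
  classical exact Finset.mem_filter

lemma mem_trunk : x ∈ trunk H T v ↔ x ∈ T ∧ ¬ ∃ c ∈ T, IsChild H v c ∧ Anc H c x := by
  classical exact Finset.mem_filter

namespace IsSubtree

lemma unique {r' : W} (h : IsSubtree H T r) (h' : IsSubtree H T r') : r = r' :=
  (h.anc _ h'.mem).antisymm (h'.anc _ h.mem)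

lemma desc (h : IsSubtree H T r) (hv : v ∈ T) : IsSubtree H (desc H T v) v where
  mem := mem_desc.2 ⟨hv, Anc.refl H v⟩
  anc _ hx := (mem_desc.1 hx).2
  between x hx y hvy hyx :=
    mem_desc.2 ⟨h.between x (mem_desc.1 hx).1 y ((h.anc v hv).trans hvy) hyx, hvy⟩

lemma trunk (h : IsSubtree H T r) (hv : v ∈ T) : IsSubtree H (trunk H T v) r where
  mem := mem_trunk.2 ⟨h.mem, fun ⟨_, _, hvc, hcr⟩ => hvc.not_anc (hcr.trans (h.anc v hv))⟩
  anc x hx := h.anc x (mem_trunk.1 hx).1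
  between x hx y hry hyx := mem_trunk.2
    ⟨h.between x (mem_trunk.1 hx).1 y hry hyx,
      fun ⟨c, hc, hvc, hcy⟩ => (mem_trunk.1 hx).2 ⟨c, hc, hvc, hcy.trans hyx⟩⟩

/-- The splitting vertex is found by descending to a smallest subtree with more than half of the
vertices. -/
lemma exists_isSplit (h : IsSubtree H T r) : ∃ v, IsSplit H T v := by
  classical
  have hr : FVSRelease.desc H T r = T := Finset.filter_true_of_mem h.anc
  have hpos : 0 < T.card := Finset.card_pos.2 ⟨r, h.mem⟩
  let heavy := T.filter fun v => T.card < 2 * (FVSRelease.desc H T v).card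
  have hheavy : heavy.Nonempty := ⟨r, Finset.mem_filter.2 ⟨h.mem, by rw [hr]; lia⟩⟩
  obtain ⟨v, hv, hmin⟩ := heavy.exists_min_image (fun v => (FVSRelease.desc H T v).card) hheavy
  simp only [heavy, Finset.mem_filter] at hv hmin
  refine ⟨v, hv.1, hv.2, fun c hc hvc => not_lt.1 fun hlt => ?_⟩
  have hsub : FVSRelease.desc H T c ⊂ FVSRelease.desc H T v :=
    Finset.ssubset_iff_of_subset (fun x hx => mem_desc.2
      ⟨(mem_desc.1 hx).1, hvc.2.trans (mem_desc.1 hx).2⟩) |>.2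
      ⟨v, mem_desc.2 ⟨hv.1, Anc.refl H v⟩, fun hx => hvc.not_anc (mem_desc.1 hx).2⟩
  exact (hmin c ⟨hc, hlt⟩).not_gt (Finset.card_lt_card hsub)

lemma isSplit_splitVertex (h : IsSubtree H T r) : IsSplit H T (splitVertex H T r) :=
  Classical.epsilon_spec h.exists_isSplit

lemma splitVertex_mem (h : IsSubtree H T r) : splitVertex H T r ∈ T := h.isSplit_splitVertex.1

lemma two_mul_card_trunk_le (hH : H.IsAcyclic) (h : IsSubtree H T r) (hv : IsSplit H T v) :
    2 * (FVSRelease.trunk H T v).card ≤ T.card + 1 := by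
  classical
  have hsub : FVSRelease.trunk H T v ⊆ insert v (T \ FVSRelease.desc H T v) := fun y hy => by
    rw [mem_trunk] at hy
    rw [Finset.mem_insert, Finset.mem_sdiff, mem_desc]
    refine or_iff_not_imp_left.2 fun hne => ⟨hy.1, fun ⟨_, hvy⟩ => hy.2 ?_⟩
    obtain ⟨c, hvc, hcy⟩ := exists_isChild_anc hH hvy (Ne.symm hne)
    exact ⟨c, h.between y hy.1 c ((h.anc v hv.1).trans hvc.2) hcy, hvc, hcy⟩
  have hcard := (Finset.card_le_card hsub).trans (Finset.card_insert_le _ _)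
  have hdesc := Finset.card_sdiff_add_card_eq_card
    (fun _ hx => (mem_desc.1 hx).1 : FVSRelease.desc H T v ⊆ T)
  have hheavy := hv.2.1
  lia

end IsSubtree

open Classical in
/-- The subtrees, with their top vertices, into which one step of the recursion divides the subtree
`T` with top vertex `r`: the trunk and the subtrees of the children of the splitting vertex. -/
noncomputable def pieces (H : SimpleGraph W) (T : Finset W) (r : W) : Finset (Finset W × W) :=
  insert (trunk H T (splitVertex H T r), r)
    ((T.filter fun c => IsChild H (splitVertex H T r) c).image fun c => (desc H T c, c))

lemma trunk_mem_pieces : (trunk H T (splitVertex H T r), r) ∈ pieces H T r := by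
  classical exact Finset.mem_insert_self _ _

lemma desc_mem_pieces (hc : c ∈ T) (hvc : IsChild H (splitVertex H T r) c) :
    (desc H T c, c) ∈ pieces H T r := by
  classical
  exact Finset.mem_insert_of_mem (Finset.mem_image_of_mem _ (Finset.mem_filter.2 ⟨hc, hvc⟩))

lemma eq_of_mem_pieces {P : Finset W × W} (hP : P ∈ pieces H T r) :
    P = (trunk H T (splitVertex H T r), r) ∨
      ∃ c ∈ T, IsChild H (splitVertex H T r) c ∧ P = (desc H T c, c) := by
  classical
  simpa only [pieces, Finset.mem_insert, Finset.mem_image, Finset.mem_filter, and_assoc,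
    eq_comm (b := P)] using hP

lemma subset_of_mem_pieces {P : Finset W × W} (hP : P ∈ pieces H T r) : P.1 ⊆ T := by
  rcases eq_of_mem_pieces hP with rfl | ⟨c, -, -, rfl⟩
  exacts [fun _ h => (mem_trunk.1 h).1, fun _ h => (mem_desc.1 h).1]

lemma pairwiseDisjoint_pieces : (pieces H T r : Set (Finset W × W)).PairwiseDisjoint Prod.fst := by
  intro P hP Q hQ hne
  refine Finset.disjoint_left.2 fun x hxP hxQ => hne ?_
  rcases eq_of_mem_pieces hP with rfl | ⟨c, hc, hvc, rfl⟩ <;>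
    rcases eq_of_mem_pieces hQ with rfl | ⟨c', hc', hvc', rfl⟩
  · rfl
  · exact absurd ⟨c', hc', hvc', (mem_desc.1 hxQ).2⟩ (mem_trunk.1 hxP).2
  · exact absurd ⟨c, hc, hvc, (mem_desc.1 hxP).2⟩ (mem_trunk.1 hxQ).2
  · rw [hvc.eq_of_anc hvc' (mem_desc.1 hxP).2 (mem_desc.1 hxQ).2]

namespace IsSubtree

variable {P : Finset W × W}

lemma of_mem_pieces (h : IsSubtree H T r) (hP : P ∈ pieces H T r) : IsSubtree H P.1 P.2 := by
  rcases eq_of_mem_pieces hP with rfl | ⟨c, hc, -, rfl⟩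
  exacts [h.trunk h.splitVertex_mem, h.desc hc]

lemma two_mul_card_le_of_mem_pieces (hH : H.IsAcyclic) (h : IsSubtree H T r)
    (hP : P ∈ pieces H T r) : 2 * P.1.card ≤ T.card + 1 := by
  rcases eq_of_mem_pieces hP with rfl | ⟨c, hc, hvc, rfl⟩
  exacts [h.two_mul_card_trunk_le hH h.isSplit_splitVertex,
    (h.isSplit_splitVertex.2.2 c hc hvc).trans (Nat.le_succ _)]

lemma clog_card_add_one_le (hH : H.IsAcyclic) (h : IsSubtree H T r) (hP : P ∈ pieces H T r)
    (hT : 1 < T.card) : Nat.clog 2 P.1.card + 1 ≤ Nat.clog 2 T.card := by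
  have hcard := h.two_mul_card_le_of_mem_pieces hH hP
  rw [Nat.clog_of_two_le one_lt_two hT]
  exact Nat.succ_le_succ (Nat.clog_mono_right 2 (by lia))

end IsSubtree

open Classical in
/-- The indices of the noise variables that enter the noisy distance from `r` to `x` in `T`; the
recursion is that of `rootedDist`. -/
noncomputable def noiseIndices (H : SimpleGraph W) :
    ℕ → Finset W → W → W → Finset (Finset W × W)
  | 0, _, _, _ => ∅
  | fuel + 1, T, r, x =>
    if T.card ≤ 1 then ∅
    else
      let v := splitVertex H T r
      if h : ∃ c ∈ T, IsChild H v c ∧ Anc H c x then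
        {(T, v), (T, h.choose)} ∪ noiseIndices H fuel (desc H T h.choose) h.choose x
      else noiseIndices H fuel (trunk H T v) r x

/-- The vertex from which distances are measured in `T`: the top vertex if `T` is a subtree. -/
noncomputable def topVertex (H : SimpleGraph W) (T : Finset W) (x : W) : W :=
  @Classical.epsilon W ⟨x⟩ fun r => IsSubtree H T r

lemma IsSubtree.topVertex_eq (h : IsSubtree H T r) (x : W) : topVertex H T x = r :=
  (Classical.epsilon_spec (p := IsSubtree H T) ⟨r, h⟩).unique h

open Classical in
/-- The exact quantity to which the noise variable of index `(T, x)` is added: the distance from the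
top of `T` to `x` if `x` is the splitting vertex, otherwise the weight of the edge from the
splitting vertex to its child `x`. -/
noncomputable def query (H : SimpleGraph W) (w : Sym2 W → ℝ≥0) (j : Finset W × W) : ℝ :=
  let r := topVertex H j.1 j.2
  let v := splitVertex H j.1 r
  if j.2 = v then wdist H w r v else w s(v, j.2)

lemma query_splitVertex (h : IsSubtree H T r) (w : Sym2 W → ℝ≥0) :
    query H w (T, splitVertex H T r) = wdist H w r (splitVertex H T r) := by
  simp [query, h.topVertex_eq]

lemma query_of_ne (h : IsSubtree H T r) (w : Sym2 W → ℝ≥0) (hx : x ≠ splitVertex H T r) :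
    query H w (T, x) = w s(splitVertex H T r, x) := by
  simp [query, h.topVertex_eq, hx]

lemma query_zero (j : Finset W × W) : query H 0 j = 0 := by
  simp [query, wdist_zero]

section Recursion

variable (w : Sym2 W → ℝ≥0) (X : Finset W × W → ℝ) (fuel : ℕ)

lemma noiseIndices_of_card_le_one (hT : T.card ≤ 1) : noiseIndices H fuel T r x = ∅ := by
  cases fuel <;> simp [noiseIndices, hT]

lemma rootedDist_of_card_le_one (hT : T.card ≤ 1) : rootedDist H w X fuel T r x = 0 := by
  cases fuel <;> simp [rootedDist, hT]

open Classical in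
lemma noiseIndices_of_isChild (hT : 1 < T.card) (hc : c ∈ T)
    (hvc : IsChild H (splitVertex H T r) c) (hcx : Anc H c x) :
    noiseIndices H (fuel + 1) T r x
      = {(T, splitVertex H T r), (T, c)} ∪ noiseIndices H fuel (desc H T c) c x := by
  have h : ∃ c ∈ T, IsChild H (splitVertex H T r) c ∧ Anc H c x := ⟨c, hc, hvc, hcx⟩
  have hchoose : h.choose = c := h.choose_spec.2.1.eq_of_anc hvc h.choose_spec.2.2 hcx
  rw [noiseIndices, if_neg hT.not_ge]
  dsimp only
  rw [dif_pos h, hchoose]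

lemma rootedDist_of_isChild (hT : 1 < T.card) (hc : c ∈ T)
    (hvc : IsChild H (splitVertex H T r) c) (hcx : Anc H c x) :
    rootedDist H w X (fuel + 1) T r x
      = wdist H w r (splitVertex H T r) + X (T, splitVertex H T r)
        + (w s(splitVertex H T r, c) + X (T, c)) + rootedDist H w X fuel (desc H T c) c x := by
  have h : ∃ c ∈ T, IsChild H (splitVertex H T r) c ∧ Anc H c x := ⟨c, hc, hvc, hcx⟩
  have hchoose : h.choose = c := h.choose_spec.2.1.eq_of_anc hvc h.choose_spec.2.2 hcx
  rw [rootedDist, if_neg hT.not_ge]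
  dsimp only
  rw [dif_pos h, hchoose]

lemma noiseIndices_of_not_anc (hT : 1 < T.card)
    (h : ¬ ∃ c ∈ T, IsChild H (splitVertex H T r) c ∧ Anc H c x) :
    noiseIndices H (fuel + 1) T r x
      = noiseIndices H fuel (trunk H T (splitVertex H T r)) r x := by
  rw [noiseIndices, if_neg hT.not_ge]
  exact dif_neg h

lemma rootedDist_of_not_anc (hT : 1 < T.card)
    (h : ¬ ∃ c ∈ T, IsChild H (splitVertex H T r) c ∧ Anc H c x) :
    rootedDist H w X (fuel + 1) T r x
      = rootedDist H w X fuel (trunk H T (splitVertex H T r)) r x := by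
  rw [rootedDist, if_neg hT.not_ge]
  exact dif_neg h

lemma fst_subset_of_mem_noiseIndices {j : Finset W × W} (hj : j ∈ noiseIndices H fuel T r x) :
    j.1 ⊆ T := by
  classical
  induction fuel generalizing T r with
  | zero => simp [noiseIndices] at hj
  | succ fuel ih =>
    rcases le_or_gt T.card 1 with hT | hT
    · simp [noiseIndices_of_card_le_one _ hT] at hj
    by_cases h : ∃ c ∈ T, IsChild H (splitVertex H T r) c ∧ Anc H c x
    · obtain ⟨c, hc, hvc, hcx⟩ := h
      simp only [noiseIndices_of_isChild _ hT hc hvc hcx, Finset.mem_union, Finset.mem_insert,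
        Finset.mem_singleton] at hj
      rcases hj with (rfl | rfl) | hj
      exacts [subset_rfl, subset_rfl, (ih hj).trans (subset_of_mem_pieces (desc_mem_pieces hc hvc))]
    · rw [noiseIndices_of_not_anc _ hT h] at hj
      exact (ih hj).trans (subset_of_mem_pieces trunk_mem_pieces)

lemma sum_noiseIndices_of_isChild (f : Finset W × W → ℝ) (hT : 1 < T.card) (hc : c ∈ T)
    (hv : splitVertex H T r ∈ T) (hvc : IsChild H (splitVertex H T r) c) (hcx : Anc H c x) :
    ∑ j ∈ noiseIndices H (fuel + 1) T r x, f j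
      = f (T, splitVertex H T r) + f (T, c) + ∑ j ∈ noiseIndices H fuel (desc H T c) c x, f j := by
  classical
  have hne : (T, splitVertex H T r) ≠ (T, c) := fun h => hvc.1.ne (congrArg Prod.snd h)
  have hdisj : Disjoint {(T, splitVertex H T r), (T, c)} (noiseIndices H fuel (desc H T c) c x) :=
    Finset.disjoint_left.2 fun j hj hj' => by
      have hjT : j.1 = T := by
        rcases Finset.mem_insert.1 hj with rfl | hj
        exacts [rfl, congrArg Prod.fst (Finset.mem_singleton.1 hj)]
      have hsub := fst_subset_of_mem_noiseIndices _ hj'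
      rw [hjT] at hsub
      exact hvc.not_anc (mem_desc.1 (hsub hv)).2
  rw [noiseIndices_of_isChild _ hT hc hvc hcx, Finset.sum_union hdisj, Finset.sum_pair hne]

lemma rootedDist_eq_sum (h : IsSubtree H T r) :
    rootedDist H w X fuel T r x = ∑ j ∈ noiseIndices H fuel T r x, (query H w j + X j) := by
  induction fuel generalizing T r with
  | zero => simp [rootedDist, noiseIndices]
  | succ fuel ih =>
    rcases le_or_gt T.card 1 with hT | hT
    · simp [noiseIndices_of_card_le_one _ hT, rootedDist_of_card_le_one _ _ _ hT]
    by_cases hx : ∃ c ∈ T, IsChild H (splitVertex H T r) c ∧ Anc H c x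
    · obtain ⟨c, hc, hvc, hcx⟩ := hx
      rw [rootedDist_of_isChild w X _ hT hc hvc hcx, ih (h.desc hc),
        sum_noiseIndices_of_isChild _ _ hT hc h.splitVertex_mem hvc hcx, query_splitVertex h,
        query_of_ne h w hvc.1.ne']
    · rw [rootedDist_of_not_anc w X _ hT hx, noiseIndices_of_not_anc _ hT hx,
        ih (h.trunk h.splitVertex_mem)]

lemma card_noiseIndices_le (hH : H.IsAcyclic) (h : IsSubtree H T r) :
    (noiseIndices H fuel T r x).card ≤ 2 * Nat.clog 2 T.card := by
  classical
  induction fuel generalizing T r with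
  | zero => simp [noiseIndices]
  | succ fuel ih =>
    rcases le_or_gt T.card 1 with hT | hT
    · simp [noiseIndices_of_card_le_one _ hT]
    by_cases hx : ∃ c ∈ T, IsChild H (splitVertex H T r) c ∧ Anc H c x
    · obtain ⟨c, hc, hvc, hcx⟩ := hx
      rw [noiseIndices_of_isChild _ hT hc hvc hcx]
      have hunion := Finset.card_union_le {(T, splitVertex H T r), (T, c)}
        (noiseIndices H fuel (desc H T c) c x)
      have hpair := Finset.card_le_two (a := (T, splitVertex H T r)) (b := (T, c))
      have hclog := h.clog_card_add_one_le hH (desc_mem_pieces hc hvc) hT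
      have hrec := ih (h.desc hc)
      lia
    · rw [noiseIndices_of_not_anc _ hT hx]
      have hclog := h.clog_card_add_one_le hH trunk_mem_pieces hT
      have hrec := ih (h.trunk h.splitVertex_mem)
      lia

lemma sum_query_noiseIndices [Finite W] (hH : H.IsAcyclic) (h : IsSubtree H T r) (hx : x ∈ T)
    (hfuel : T.card ≤ fuel) : ∑ j ∈ noiseIndices H fuel T r x, query H w j = wdist H w r x := by
  induction fuel generalizing T r with
  | zero => simp [Finset.card_eq_zero.1 (Nat.le_zero.1 hfuel)] at hx
  | succ fuel ih =>
    rcases le_or_gt T.card 1 with hT | hT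
    · simp [noiseIndices_of_card_le_one _ hT, Finset.card_le_one.1 hT x hx r h.mem, wdist_self]
    have hv := h.splitVertex_mem
    by_cases hcx : ∃ c ∈ T, IsChild H (splitVertex H T r) c ∧ Anc H c x
    · obtain ⟨c, hc, hvc, hcx⟩ := hcx
      have hcard := h.two_mul_card_le_of_mem_pieces hH (desc_mem_pieces hc hvc)
      rw [sum_noiseIndices_of_isChild _ _ hT hc hv hvc hcx,
        ih (h.desc hc) (mem_desc.2 ⟨hx, hcx⟩) (by lia), query_splitVertex h,
        query_of_ne h w hvc.1.ne', ← wdist_eq_of_adj hH w hvc.1,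
        ← wdist_eq_add_of_anc w (h.anc _ hv) hvc.2,
        ← wdist_eq_add_of_anc w (h.anc c hc) hcx]
    · have hcard := h.two_mul_card_le_of_mem_pieces hH trunk_mem_pieces
      rw [noiseIndices_of_not_anc _ hT hcx,
        ih (h.trunk hv) (mem_trunk.2 ⟨hx, hcx⟩) (by lia)]

end Recursion

end Decomposition

section ForestDist

variable {W : Type*} [Fintype W] {H : SimpleGraph W} {x y : W}

open Classical in
/-- The vertices of the tree of `x`. -/
noncomputable def treeOf (H : SimpleGraph W) (x : W) : Finset W :=
  Finset.univ.filter fun y => H.Reachable x y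

lemma mem_treeOf : y ∈ treeOf H x ↔ H.Reachable x y := by
  classical exact Finset.mem_filter_univ y

lemma treeOf_eq_of_reachable (h : H.Reachable x y) : treeOf H x = treeOf H y := by
  ext z
  rw [mem_treeOf, mem_treeOf]
  exact ⟨h.symm.trans, h.trans⟩

lemma isSubtree_treeOf (H : SimpleGraph W) (x : W) : IsSubtree H (treeOf H x) (root H x) where
  mem := mem_treeOf.2 (reachable_root H x).symm
  anc y hy := root_eq_of_reachable (mem_treeOf.1 hy) ▸ Anc.root H y
  between _ hy _ _ hzy := mem_treeOf.2 ((mem_treeOf.1 hy).trans hzy.reachable.symm)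

/-- The indices of the noise variables that enter the noisy distance from the root to `x`. -/
noncomputable def rootNoiseIndices (H : SimpleGraph W) (x : W) : Finset (Finset W × W) :=
  noiseIndices H (Fintype.card W) (treeOf H x) (root H x) x

lemma card_rootNoiseIndices_le (hH : H.IsAcyclic) (x : W) :
    (rootNoiseIndices H x).card ≤ 2 * Nat.clog 2 (Fintype.card W) :=
  (card_noiseIndices_le _ hH (isSubtree_treeOf H x)).trans
    (Nat.mul_le_mul_left 2 (Nat.clog_mono_right 2 (Finset.card_le_univ _)))

lemma rootDist_eq_sum [DecidableEq W] (H : SimpleGraph W) (w : Sym2 W → ℝ≥0)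
    (X : Finset W × W → ℝ) (x : W) :
    rootDist H w X x = ∑ j ∈ rootNoiseIndices H x, (query H w j + X j) := by
  rw [rootNoiseIndices, ← rootedDist_eq_sum w X _ (isSubtree_treeOf H x), rootDist]
  congr 1
  ext y
  simp [mem_treeOf]

lemma rootDist_eq_wdist_add_sum [DecidableEq W] (hH : H.IsAcyclic) (w : Sym2 W → ℝ≥0)
    (X : Finset W × W → ℝ) (x : W) :
    rootDist H w X x = wdist H w (root H x) x + ∑ j ∈ rootNoiseIndices H x, X j := by
  rw [rootDist_eq_sum, Finset.sum_add_distrib, rootNoiseIndices,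
    sum_query_noiseIndices w _ hH (isSubtree_treeOf H x)
      (mem_treeOf.2 (Reachable.refl x)) (Finset.card_le_univ _)]

lemma forestDist_of_reachable [DecidableEq W] (hH : H.IsAcyclic) (w : Sym2 W → ℝ≥0)
    (X : Finset W × W → ℝ) (h : H.Reachable x y) :
    forestDist H w X x y = ((wdist H w x y + (∑ j ∈ rootNoiseIndices H x, X j
      + ∑ j ∈ rootNoiseIndices H y, X j
      - 2 * ∑ j ∈ rootNoiseIndices H (lca H x y), X j) : ℝ) : EReal) := by
  rw [forestDist, if_pos h, rootDist_eq_wdist_add_sum hH, rootDist_eq_wdist_add_sum hH,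
    rootDist_eq_wdist_add_sum hH, wdist_eq_of_isLCA hH w (isLCA_lca h)]
  congr 1
  ring

lemma forestDist_of_not_reachable [DecidableEq W] (w : Sym2 W → ℝ≥0)
    (X : Finset W × W → ℝ) (h : ¬ H.Reachable x y) : forestDist H w X x y = ⊤ :=
  if_neg h

end ForestDist

section Sensitivity

variable {W : Type*} {H : SimpleGraph W} {T : Finset W} {r : W}

lemma sum_biUnion_le_of_nonneg {ι κ : Type*} [DecidableEq ι] (s : Finset κ) (t : κ → Finset ι)
    {f : ι → ℝ} (hf : ∀ i, 0 ≤ f i) : ∑ i ∈ s.biUnion t, f i ≤ ∑ a ∈ s, ∑ i ∈ t a, f i := by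
  classical
  have himage : s.biUnion t = (s.sigma t).image Sigma.snd := by
    ext i; simp
  rw [himage, ← Finset.sum_sigma s t fun p => f p.2]
  exact Finset.sum_image_le_of_nonneg fun i _ => hf _

/-- The path from the top of `T` to its splitting vertex and the edges from there to the children
are disjoint, so that the queries at `T` together depend on every edge weight at most once. -/
lemma sum_abs_query_sub_le (hH : H.IsAcyclic) (w w' : Sym2 W → ℝ≥0) (h : IsSubtree H T r)
    {C : Finset W} (hCT : C ⊆ T) (hC : ∀ c ∈ C, IsChild H (splitVertex H T r) c) :
    |query H w (T, splitVertex H T r) - query H w' (T, splitVertex H T r)|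
      + ∑ c ∈ C, |query H w (T, c) - query H w' (T, c)| ≤ weightChange H w w' T := by
  classical
  have hv := h.splitVertex_mem
  set v := splitVertex H T r with hv_def
  have hrv := h.anc v hv
  obtain ⟨p, hp⟩ := hrv.reachable.exists_isPath
  have hsplit : |query H w (T, v) - query H w' (T, v)|
      ≤ ∑ e ∈ p.edges.toFinset, |(w e : ℝ) - w' e| := by
    rw [query_splitVertex h, query_splitVertex h, ← hv_def, wdist_eq_walkWeight hH w hp,
      wdist_eq_walkWeight hH w' hp]
    exact abs_walkWeight_sub_le w w' hp.isTrail
  have hchildren : ∑ c ∈ C, |query H w (T, c) - query H w' (T, c)|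
      = ∑ e ∈ C.image fun c => s(v, c), |(w e : ℝ) - w' e| := by
    rw [Finset.sum_image fun _ _ _ _ => Sym2.congr_right.1]
    refine Finset.sum_congr rfl fun c hc => ?_
    rw [query_of_ne h w (hC c hc).1.ne', query_of_ne h w' (hC c hc).1.ne']
  have hdisj : Disjoint p.edges.toFinset (C.image fun c => s(v, c)) := by
    refine Finset.disjoint_left.2 fun e he he' => ?_
    obtain ⟨c, hc, rfl⟩ := Finset.mem_image.1 he'
    have hcp := p.snd_mem_support_of_mem_edges (List.mem_toFinset.1 he)
    exact (hC c hc).not_anc ((mem_support_iff_of_anc hH hrv hp).1 hcp).2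
  rw [hchildren]
  refine (add_le_add_left hsplit _).trans ?_
  rw [← Finset.sum_union hdisj]
  refine sum_abs_sub_le_weightChange fun e he => ?_
  rcases Finset.mem_union.1 he with he | he
  · rw [List.mem_toFinset] at he
    refine ⟨p.edges_subset_edgeSet he, fun x hx => ?_⟩
    have hrx := (mem_support_iff_of_anc hH hrv hp).1 (p.mem_support_of_mem_edges he hx)
    exact h.between v hv x hrx.1 hrx.2
  · obtain ⟨c, hc, rfl⟩ := Finset.mem_image.1 he
    exact ⟨(hC c hc).1, by simp [hv, hCT hc]⟩

open Classical in
/-- The indices of all noise variables drawn by the recursion that starts at `T`. -/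
noncomputable def subtreeIndices (H : SimpleGraph W) (fuel : ℕ) (T : Finset W) (r : W) :
    Finset (Finset W × W) :=
  T.biUnion (noiseIndices H fuel T r)

lemma subtreeIndices_of_card_le_one (fuel : ℕ) (hT : T.card ≤ 1) :
    subtreeIndices H fuel T r = ∅ := by
  classical
  exact Finset.subset_empty.1 <|
    Finset.biUnion_subset.2 fun _ _ => (noiseIndices_of_card_le_one _ hT).subset

lemma subtreeIndices_zero : subtreeIndices H 0 T r = ∅ := by
  classical
  exact Finset.subset_empty.1 <| Finset.biUnion_subset.2 fun _ _ => Finset.empty_subset _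

open Classical in
lemma subtreeIndices_succ_subset (fuel : ℕ) (hT : 1 < T.card) :
    subtreeIndices H (fuel + 1) T r ⊆
      (insert (splitVertex H T r) (T.filter fun c => IsChild H (splitVertex H T r) c)).image
          (fun x => (T, x))
        ∪ (pieces H T r).biUnion fun P => subtreeIndices H fuel P.1 P.2 := by
  intro j hj
  obtain ⟨x, hx, hj⟩ := Finset.mem_biUnion.1 hj
  by_cases h : ∃ c ∈ T, IsChild H (splitVertex H T r) c ∧ Anc H c x
  · obtain ⟨c, hc, hvc, hcx⟩ := h
    rw [noiseIndices_of_isChild _ hT hc hvc hcx] at hj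
    rcases Finset.mem_union.1 hj with hj | hj
    · refine Finset.mem_union_left _ ?_
      rcases Finset.mem_insert.1 hj with rfl | hj
      · exact Finset.mem_image_of_mem _ (Finset.mem_insert_self _ _)
      · rw [Finset.mem_singleton.1 hj]
        exact Finset.mem_image_of_mem _
          (Finset.mem_insert_of_mem (Finset.mem_filter.2 ⟨hc, hvc⟩))
    · exact Finset.mem_union_right _ (Finset.mem_biUnion.2 ⟨_, desc_mem_pieces hc hvc,
        Finset.mem_biUnion.2 ⟨x, mem_desc.2 ⟨hx, hcx⟩, hj⟩⟩)
  · rw [noiseIndices_of_not_anc _ hT h] at hj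
    exact Finset.mem_union_right _ (Finset.mem_biUnion.2 ⟨_, trunk_mem_pieces,
      Finset.mem_biUnion.2 ⟨x, mem_trunk.2 ⟨hx, h⟩, hj⟩⟩)

open Classical in
lemma sum_subtreeIndices_succ_le (fuel : ℕ) (hT : 1 < T.card) {f : Finset W × W → ℝ}
    (hf : ∀ j, 0 ≤ f j) :
    ∑ j ∈ subtreeIndices H (fuel + 1) T r, f j
      ≤ f (T, splitVertex H T r)
        + ∑ c ∈ T.filter fun c => IsChild H (splitVertex H T r) c, f (T, c)
        + ∑ P ∈ pieces H T r, ∑ j ∈ subtreeIndices H fuel P.1 P.2, f j := by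
  set v := splitVertex H T r
  let C := T.filter fun c => IsChild H v c
  have hvC : v ∉ C := fun hv => (Finset.mem_filter.1 hv).2.1.ne rfl
  have hlevel : ∑ j ∈ (insert v C).image fun x => (T, x), f j
      = f (T, v) + ∑ c ∈ C, f (T, c) := by
    rw [Finset.sum_image fun _ _ _ _ => congrArg Prod.snd, Finset.sum_insert hvC]
  calc ∑ j ∈ subtreeIndices H (fuel + 1) T r, f j
      ≤ ∑ j ∈ (insert v C).image fun x => (T, x), f j
        + ∑ j ∈ (pieces H T r).biUnion fun P => subtreeIndices H fuel P.1 P.2, f j := by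
        rw [← Finset.sum_union_inter]
        exact (Finset.sum_le_sum_of_subset_of_nonneg (subtreeIndices_succ_subset fuel hT)
          fun _ _ _ => hf _).trans (le_add_of_nonneg_right (Finset.sum_nonneg fun _ _ => hf _))
    _ ≤ _ := add_le_add hlevel.le (sum_biUnion_le_of_nonneg _ _ hf)

/-- Each of the `clog 2 |T|` levels of the recursion works on disjoint subtrees and hence changes
by at most `weightChange H w w' T`. -/
lemma sum_subtreeIndices_le (hH : H.IsAcyclic) (w w' : Sym2 W → ℝ≥0) (fuel : ℕ)
    (h : IsSubtree H T r) :
    ∑ j ∈ subtreeIndices H fuel T r, |query H w j - query H w' j|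
      ≤ Nat.clog 2 T.card * weightChange H w w' T := by
  classical
  have hnonneg (T : Finset W) : 0 ≤ Nat.clog 2 T.card * weightChange H w w' T :=
    mul_nonneg (Nat.cast_nonneg _) (weightChange_nonneg _ _ _)
  induction fuel generalizing T r with
  | zero => simpa [subtreeIndices_zero] using hnonneg T
  | succ fuel ih =>
    rcases le_or_gt T.card 1 with hT | hT
    · simpa [subtreeIndices_of_card_le_one _ hT] using hnonneg T
    have hpiece : ∀ P ∈ pieces H T r,
        ∑ j ∈ subtreeIndices H fuel P.1 P.2, |query H w j - query H w' j|
          ≤ (Nat.clog 2 T.card - 1) * weightChange H w w' P.1 := fun P hP => by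
      have hclog := h.clog_card_add_one_le hH hP hT
      refine (ih (h.of_mem_pieces hP)).trans
        (mul_le_mul_of_nonneg_right ?_ (weightChange_nonneg _ _ _))
      rw [le_sub_iff_add_le]
      exact_mod_cast hclog
    have hclog_pos : (0 : ℝ) ≤ Nat.clog 2 T.card - 1 :=
      sub_nonneg.2 (Nat.one_le_cast.2 (Nat.clog_pos one_lt_two hT))
    calc ∑ j ∈ subtreeIndices H (fuel + 1) T r, |query H w j - query H w' j|
        ≤ weightChange H w w' T
          + ∑ P ∈ pieces H T r, (Nat.clog 2 T.card - 1) * weightChange H w w' P.1 :=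
          (sum_subtreeIndices_succ_le fuel hT fun _ => abs_nonneg _).trans
            (add_le_add (sum_abs_query_sub_le hH w w' h (Finset.filter_subset _ _)
              fun c hc => (Finset.mem_filter.1 hc).2) (Finset.sum_le_sum hpiece))
      _ ≤ weightChange H w w' T + (Nat.clog 2 T.card - 1) * weightChange H w w' T := by
          rw [← Finset.mul_sum]
          exact add_le_add_right (mul_le_mul_of_nonneg_left
            (sum_weightChange_le w w' (fun _ => subset_of_mem_pieces) pairwiseDisjoint_pieces)
            hclog_pos) _
      _ = Nat.clog 2 T.card * weightChange H w w' T := by ring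

variable [Fintype W]

open Classical in
/-- The indices of all noise variables used by the forest mechanism. -/
noncomputable def forestIndices (H : SimpleGraph W) : Finset (Finset W × W) :=
  Finset.univ.biUnion (rootNoiseIndices H)

lemma mem_forestIndices {j : Finset W × W} :
    j ∈ forestIndices H ↔ ∃ x, j ∈ rootNoiseIndices H x := by
  simp [forestIndices]

/-- The exact quantities released by the forest mechanism, as a function of the noise index. -/
noncomputable def forestQuery (H : SimpleGraph W) (w : Sym2 W → ℝ≥0) : Finset W × W → ℝ :=
  Set.indicator (forestIndices H) (query H w)

lemma forestDist_eq_forestDist_zero [DecidableEq W] (w : Sym2 W → ℝ≥0)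
    (X : Finset W × W → ℝ) (x y : W) :
    forestDist H w X x y = forestDist H 0 (X + forestQuery H w) x y := by
  have hroot (x : W) : rootDist H w X x = rootDist H 0 (X + forestQuery H w) x := by
    rw [rootDist_eq_sum, rootDist_eq_sum]
    refine Finset.sum_congr rfl fun j hj => ?_
    have hmem : j ∈ (forestIndices H : Set (Finset W × W)) := mem_forestIndices.2 ⟨x, hj⟩
    rw [Pi.add_apply, forestQuery, Set.indicator_of_mem hmem, query_zero]
    ring
  simp only [forestDist, hroot]

lemma pairwiseDisjoint_treeOf (H : SimpleGraph W) :
    (Set.range (root H)).PairwiseDisjoint (treeOf H) := by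
  rintro _ ⟨x, rfl⟩ _ ⟨y, rfl⟩ hne
  refine Finset.disjoint_left.2 fun z hxz hyz => hne (root_eq_of_reachable ?_)
  exact (reachable_root H x).symm.trans ((mem_treeOf.1 hxz).trans
    ((mem_treeOf.1 hyz).symm.trans (reachable_root H y)))

open Classical in
lemma forestIndices_subset_biUnion_subtreeIndices (H : SimpleGraph W) :
    forestIndices H ⊆ (Finset.univ.image (root H)).biUnion fun r =>
      subtreeIndices H (Fintype.card W) (treeOf H r) r := by
  refine Finset.biUnion_subset.2 fun x _ j hj => Finset.mem_biUnion.2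
    ⟨root H x, Finset.mem_image_of_mem _ (Finset.mem_univ x), Finset.mem_biUnion.2 ⟨x, ?_⟩⟩
  rw [treeOf_eq_of_reachable (reachable_root H x)]
  exact ⟨mem_treeOf.2 (Reachable.refl x), hj⟩

lemma sum_abs_forestQuery_sub_le (hH : H.IsAcyclic) (w w' : Sym2 W → ℝ≥0) :
    ∑ j, |forestQuery H w j - forestQuery H w' j|
      ≤ Nat.clog 2 (Fintype.card W) * weightChange H w w' Finset.univ := by
  classical
  let f (j : Finset W × W) : ℝ := |query H w j - query H w' j|
  let roots := Finset.univ.image (root H)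
  have htree : ∀ r ∈ roots, ∑ j ∈ subtreeIndices H (Fintype.card W) (treeOf H r) r, f j
      ≤ Nat.clog 2 (Fintype.card W) * weightChange H w w' (treeOf H r) := fun r hr => by
    obtain ⟨x, -, rfl⟩ := Finset.mem_image.1 hr
    have hsub := isSubtree_treeOf H x
    rw [← treeOf_eq_of_reachable (reachable_root H x)] at hsub
    exact (sum_subtreeIndices_le hH w w' _ hsub).trans (mul_le_mul_of_nonneg_right
      (Nat.cast_le.2 (Nat.clog_mono_right 2 (Finset.card_le_univ _))) (weightChange_nonneg _ _ _))
  have hdisj : (roots : Set W).PairwiseDisjoint (treeOf H) := by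
    simpa [roots] using pairwiseDisjoint_treeOf H
  calc ∑ j, |forestQuery H w j - forestQuery H w' j| = ∑ j ∈ forestIndices H, f j := by
        rw [← Finset.sum_subset (Finset.subset_univ (forestIndices H)) fun j _ hj => by
          simp [forestQuery, hj]]
        exact Finset.sum_congr rfl fun j hj => by simp [forestQuery, hj, f]
    _ ≤ ∑ r ∈ roots, ∑ j ∈ subtreeIndices H (Fintype.card W) (treeOf H r) r, f j :=
        (Finset.sum_le_sum_of_subset_of_nonneg (forestIndices_subset_biUnion_subtreeIndices H)
          fun _ _ _ => abs_nonneg _).trans (sum_biUnion_le_of_nonneg _ _ fun _ => abs_nonneg _)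
    _ ≤ ∑ r ∈ roots, Nat.clog 2 (Fintype.card W) * weightChange H w w' (treeOf H r) :=
        Finset.sum_le_sum htree
    _ ≤ Nat.clog 2 (Fintype.card W) * weightChange H w w' Finset.univ := by
        rw [← Finset.mul_sum]
        exact mul_le_mul_of_nonneg_left
          (sum_weightChange_le w w' (fun _ _ => Finset.subset_univ _) hdisj) (Nat.cast_nonneg _)

end Sensitivity

section PrivacyLoss

variable {Ω Ω' : Type*} [MeasurableSpace Ω] [MeasurableSpace Ω'] {ε ε₁ ε₂ δ : ℝ}

/-- The inequality of `(ε, δ)`-differential privacy for a pair of output laws. -/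
def Indist (ε δ : ℝ) (μ ν : Measure Ω) : Prop :=
  ∀ O : Set Ω, MeasurableSet O → μ O ≤ ENNReal.ofReal (Real.exp ε) * ν O + ENNReal.ofReal δ

lemma Indist.refl (hε : 0 ≤ ε) (μ : Measure Ω) : Indist ε δ μ μ := fun _ _ =>
  le_add_right <| le_mul_of_one_le_left zero_le (ENNReal.one_le_ofReal.2 (Real.one_le_exp hε))

lemma Indist.mono {μ ν : Measure Ω} (h : Indist ε₁ δ μ ν) (hε : ε₁ ≤ ε₂) : Indist ε₂ δ μ ν :=
  fun O hO => (h O hO).trans (by gcongr)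

lemma Indist.map {μ ν : Measure Ω} (h : Indist ε δ μ ν) {f : Ω → Ω'} (hf : Measurable f) :
    Indist ε δ (μ.map f) (ν.map f) := fun O hO => by
  rw [Measure.map_apply hf hO, Measure.map_apply hf hO]
  exact h _ (hf hO)

section Prod

variable {μ μ' : Measure Ω} {ν ν' : Measure Ω'} [SFinite ν']

lemma Indist.prod [IsProbabilityMeasure μ] [SFinite ν] (h₁ : Indist ε₁ 0 μ μ')
    (h₂ : Indist ε₂ δ ν ν') :
    Indist (ε₁ + ε₂) δ (μ.prod ν) (μ'.prod ν') := by
  have hle : μ ≤ ENNReal.ofReal (Real.exp ε₁) • μ' := Measure.le_iff.2 fun s hs => by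
    simpa using h₁ s hs
  intro O hO
  have hm := measurable_measure_prodMk_left (ν := ν') hO
  rw [Measure.prod_apply hO, Measure.prod_apply hO]
  calc ∫⁻ x, ν (Prod.mk x ⁻¹' O) ∂μ
      ≤ ∫⁻ x, (ENNReal.ofReal (Real.exp ε₂) * ν' (Prod.mk x ⁻¹' O) + ENNReal.ofReal δ) ∂μ :=
        lintegral_mono fun x => h₂ _ (measurable_prodMk_left hO)
    _ = ENNReal.ofReal (Real.exp ε₂) * ∫⁻ x, ν' (Prod.mk x ⁻¹' O) ∂μ + ENNReal.ofReal δ := by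
        rw [lintegral_add_right _ measurable_const, lintegral_const_mul _ hm, lintegral_const,
          measure_univ, mul_one]
    _ ≤ ENNReal.ofReal (Real.exp ε₂)
          * ∫⁻ x, ν' (Prod.mk x ⁻¹' O) ∂(ENNReal.ofReal (Real.exp ε₁) • μ')
          + ENNReal.ofReal δ := by
        gcongr
    _ = _ := by
        rw [lintegral_smul_measure, smul_eq_mul, ← mul_assoc, Real.exp_add,
          ENNReal.ofReal_mul (Real.exp_pos _).le, mul_comm (ENNReal.ofReal (Real.exp ε₂))]

lemma Indist.prod_symm [SFinite μ] [SFinite μ'] [IsProbabilityMeasure ν]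
    (h₁ : Indist ε₁ δ μ μ') (h₂ : Indist ε₂ 0 ν ν') :
    Indist (ε₁ + ε₂) δ (μ.prod ν) (μ'.prod ν') := by
  rw [← Measure.prod_swap (μ := ν) (ν := μ), ← Measure.prod_swap (μ := ν') (ν := μ'), add_comm]
  exact (h₂.prod h₁).map measurable_swap

end Prod

/-- `L` is the privacy loss of `μ` against `ν`, i.e. the logarithm of the density of `μ` with
respect to `ν`. -/
structure IsPrivacyLoss (L : Ω → ℝ) (μ ν : Measure Ω) : Prop where
  measurable : Measurable L
  eq_withDensity : μ = ν.withDensity fun x => ENNReal.ofReal (Real.exp (L x))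

namespace IsPrivacyLoss

variable {L : Ω → ℝ} {μ ν : Measure Ω} {c : ℝ≥0}

lemma neg (h : IsPrivacyLoss L μ ν) : IsPrivacyLoss (fun x => -L x) ν μ where
  measurable := h.measurable.neg
  eq_withDensity := by
    have hL := h.measurable
    have hexp : (fun x => ENNReal.ofReal (Real.exp (L x))) *
        (fun x => ENNReal.ofReal (Real.exp (-L x))) = 1 := by
      ext x
      rw [Pi.mul_apply, ← ENNReal.ofReal_mul (Real.exp_pos _).le, ← Real.exp_add]
      simp
    rw [h.eq_withDensity, ← withDensity_mul _ (by fun_prop) (by fun_prop), hexp, withDensity_one]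

lemma indist_of_measure_lt_le (h : IsPrivacyLoss L μ ν)
    (hδ : μ {x | ε < L x} ≤ ENNReal.ofReal δ) : Indist ε δ μ ν := fun O hO => by
  have hset : MeasurableSet {x | L x ≤ ε} := measurableSet_le h.measurable measurable_const
  have hgood : μ (O ∩ {x | L x ≤ ε}) ≤ ENNReal.ofReal (Real.exp ε) * ν O := by
    calc μ (O ∩ {x | L x ≤ ε})
        = ∫⁻ x in O ∩ {x | L x ≤ ε}, ENNReal.ofReal (Real.exp (L x)) ∂ν := by
          rw [h.eq_withDensity, withDensity_apply _ (hO.inter hset)]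
      _ ≤ ∫⁻ _ in O ∩ {x | L x ≤ ε}, ENNReal.ofReal (Real.exp ε) ∂ν :=
          setLIntegral_mono measurable_const fun x hx =>
            ENNReal.ofReal_le_ofReal (Real.exp_le_exp.2 hx.2)
      _ = ENNReal.ofReal (Real.exp ε) * ν (O ∩ {x | L x ≤ ε}) := setLIntegral_const _ _
      _ ≤ ENNReal.ofReal (Real.exp ε) * ν O := by gcongr; exact Set.inter_subset_left
  have hcover : O ⊆ O ∩ {x | L x ≤ ε} ∪ {x | ε < L x} := fun x hx =>
    (le_or_gt (L x) ε).imp (And.intro hx) id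
  exact (measure_mono hcover).trans ((measure_union_le _ _).trans (add_le_add hgood hδ))

lemma hasSubgaussianMGF [IsProbabilityMeasure μ] (h : IsPrivacyLoss L μ ν)
    (hc : ∀ x, |L x| ≤ c) :
    ProbabilityTheory.HasSubgaussianMGF (fun x => L x - ∫ y, L y ∂μ) (c ^ 2) μ := by
  have hmem : ∀ x, L x ∈ Set.Icc (-(c : ℝ)) c := fun x => abs_le.1 (hc x)
  convert ProbabilityTheory.hasSubgaussianMGF_of_mem_Icc (μ := μ) h.measurable.aemeasurable
    (Filter.Eventually.of_forall hmem) using 1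
  rw [← NNReal.coe_inj]
  push_cast
  rw [sub_neg_eq_add, Real.norm_of_nonneg (by positivity)]
  ring

/-- Since `E exp (-L) = 1`, the subgaussian bound on `E exp (E L - L)` bounds `exp (E L)`. -/
lemma integral_le [IsProbabilityMeasure μ] [IsProbabilityMeasure ν] (h : IsPrivacyLoss L μ ν)
    (hc : ∀ x, |L x| ≤ c) : ∫ x, L x ∂μ ≤ c ^ 2 / 2 := by
  have hL := h.measurable
  have hexp : ∫ x, Real.exp (-L x) ∂μ = 1 := by
    have huniv : ν Set.univ = 1 := measure_univ
    rw [h.neg.eq_withDensity, withDensity_apply _ MeasurableSet.univ,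
      Measure.restrict_univ] at huniv
    rw [integral_eq_lintegral_of_nonneg_ae
      (Filter.Eventually.of_forall fun _ => (Real.exp_pos _).le) (by fun_prop), huniv,
      ENNReal.toReal_one]
  have hmgf := (h.hasSubgaussianMGF hc).mgf_le (-1)
  have hmul : ∀ x, Real.exp (-1 * (L x - ∫ y, L y ∂μ))
      = Real.exp (∫ y, L y ∂μ) * Real.exp (-L x) := fun x => by
    rw [← Real.exp_add]
    ring_nf
  simp_rw [ProbabilityTheory.mgf, hmul] at hmgf
  rw [integral_const_mul, hexp, mul_one, Real.exp_le_exp] at hmgf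
  simpa using hmgf

end IsPrivacyLoss

end PrivacyLoss

section ProductMeasure

variable {ι : Type*} [Fintype ι] {Ω : ι → Type*} [∀ i, MeasurableSpace (Ω i)]
  {μ ν : ∀ i, Measure (Ω i)} [∀ i, IsProbabilityMeasure (μ i)] [∀ i, IsProbabilityMeasure (ν i)]

variable (μ) in
lemma lintegral_pi_prod (s : Finset ι) {f : ∀ i, Ω i → ℝ≥0∞} (hf : ∀ i, Measurable (f i)) :
    ∫⁻ x, ∏ i ∈ s, f i (x i) ∂(Measure.pi μ) = ∏ i ∈ s, ∫⁻ y, f i y ∂(μ i) := by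
  rw [ProbabilityTheory.lintegral_prod_eq_prod_lintegral_of_indepFun s
    (fun i (x : ∀ i, Ω i) => f i (x i))
    (ProbabilityTheory.iIndepFun_pi fun i => (hf i).aemeasurable)
    fun i => (hf i).comp (measurable_pi_apply i)]
  exact Finset.prod_congr rfl fun i _ => (measurePreserving_eval μ i).lintegral_comp (hf i)

lemma pi_withDensity {f : ∀ i, Ω i → ℝ≥0∞} (hf : ∀ i, Measurable (f i))
    [∀ i, SigmaFinite ((μ i).withDensity (f i))] :
    Measure.pi (fun i => (μ i).withDensity (f i))
      = (Measure.pi μ).withDensity fun x => ∏ i, f i (x i) := by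
  refine Measure.pi_eq fun s hs => ?_
  have hbox := MeasurableSet.univ_pi hs
  have hindicator : ∀ x : ∀ i, Ω i, (Set.univ.pi s).indicator (fun x => ∏ i, f i (x i)) x
      = ∏ i, (s i).indicator (f i) (x i) := fun x => by
    by_cases hx : x ∈ Set.univ.pi s
    · rw [Set.indicator_of_mem hx]
      exact Finset.prod_congr rfl fun i _ => (Set.indicator_of_mem (hx i trivial) _).symm
    · rw [Set.indicator_of_notMem hx]
      obtain ⟨i, hi⟩ := not_forall.1 (mt Set.mem_univ_pi.2 hx)
      exact (Finset.prod_eq_zero (Finset.mem_univ i) (Set.indicator_of_notMem hi _)).symm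
  rw [withDensity_apply _ hbox, ← lintegral_indicator hbox, lintegral_congr hindicator,
    lintegral_pi_prod μ _ fun i => (hf i).indicator (hs i)]
  exact Finset.prod_congr rfl fun i _ => by
    rw [lintegral_indicator (hs i), withDensity_apply _ (hs i)]

namespace IsPrivacyLoss

variable {L : ∀ i, Ω i → ℝ}

lemma pi (h : ∀ i, IsPrivacyLoss (L i) (μ i) (ν i)) :
    IsPrivacyLoss (fun x => ∑ i, L i (x i)) (Measure.pi μ) (Measure.pi ν) where
  measurable := Finset.measurable_fun_sum _ fun i _ =>
    (h i).measurable.comp (measurable_pi_apply i)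
  eq_withDensity := by
    have hL := fun i => (h i).measurable
    have : ∀ i, IsProbabilityMeasure
        ((ν i).withDensity fun x => ENNReal.ofReal (Real.exp (L i x))) := fun i => by
      rw [← (h i).eq_withDensity]
      infer_instance
    simp_rw [Real.exp_sum, ENNReal.ofReal_prod_of_nonneg fun _ _ => (Real.exp_pos _).le]
    rw [← pi_withDensity (f := fun i y => ENNReal.ofReal (Real.exp (L i y)))
      fun i => by have := hL i; fun_prop]
    exact congrArg Measure.pi (funext fun i => (h i).eq_withDensity)

lemma measureReal_sum_ge_le (h : ∀ i, IsPrivacyLoss (L i) (μ i) (ν i)) {c : ℝ≥0} (s : Finset ι)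
    (hc : ∀ i ∈ s, ∀ x, |L i x| ≤ c) {t : ℝ} (ht : 0 ≤ t) :
    (Measure.pi μ).real {x | s.card * c ^ 2 / 2 + t ≤ ∑ i ∈ s, L i (x i)}
      ≤ Real.exp (-t ^ 2 / (2 * (s.card * c ^ 2))) := by
  let Y (i : ι) (x : ∀ i, Ω i) : ℝ := L i (x i) - ∫ y, L i y ∂(μ i)
  have hindep : ProbabilityTheory.iIndepFun Y (Measure.pi μ) :=
    ProbabilityTheory.iIndepFun_pi (X := fun i y => L i y - ∫ z, L i z ∂(μ i))
      fun i => ((h i).measurable.sub_const _).aemeasurable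
  have hsubG : ∀ i ∈ s, ProbabilityTheory.HasSubgaussianMGF (Y i) (c ^ 2) (Measure.pi μ) :=
    fun i hi => by
      refine ProbabilityTheory.HasSubgaussianMGF.of_map
        (Y := (Function.eval i : (∀ i, Ω i) → Ω i)) (X := fun y => L i y - ∫ z, L i z ∂(μ i))
        (measurable_pi_apply i).aemeasurable ?_
      rw [(measurePreserving_eval μ i).map_eq]
      exact (h i).hasSubgaussianMGF (hc i hi)
  have hmean : ∑ i ∈ s, ∫ y, L i y ∂(μ i) ≤ s.card * c ^ 2 / 2 := by
    refine (Finset.sum_le_sum fun i hi => (h i).integral_le (hc i hi)).trans_eq ?_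
    rw [Finset.sum_const, nsmul_eq_mul, mul_div_assoc]
  have htail :=
    ProbabilityTheory.HasSubgaussianMGF.measure_sum_ge_le_of_iIndepFun hindep hsubG ht
  rw [Finset.sum_const, nsmul_eq_mul] at htail
  push_cast at htail
  refine le_trans (measureReal_mono fun x hx => ?_) htail
  rw [Set.mem_ofPred_eq] at hx ⊢
  rw [Finset.sum_sub_distrib]
  linarith

lemma indist_pi (h : ∀ i, IsPrivacyLoss (L i) (μ i) (ν i)) {c : ℝ≥0} (s : Finset ι)
    (hc : ∀ i ∈ s, ∀ x, |L i x| ≤ c) (hs : ∀ i ∉ s, L i = 0) {t : ℝ} (ht : 0 ≤ t) :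
    Indist (s.card * c ^ 2 / 2 + t) (Real.exp (-t ^ 2 / (2 * (s.card * c ^ 2))))
      (Measure.pi μ) (Measure.pi ν) := by
  refine (IsPrivacyLoss.pi h).indist_of_measure_lt_le ?_
  rw [ENNReal.le_ofReal_iff_toReal_le (measure_ne_top _ _) (Real.exp_pos _).le]
  refine (measureReal_mono fun x hx => ?_).trans (measureReal_sum_ge_le h s hc ht)
  have hsum : ∑ i ∈ s, L i (x i) = ∑ i, L i (x i) :=
    Finset.sum_subset (Finset.subset_univ s) fun i _ hi => by rw [hs i hi, Pi.zero_apply]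
  rw [Set.mem_ofPred_eq] at hx ⊢
  rw [hsum]
  exact hx.le

end IsPrivacyLoss

end ProductMeasure

section Laplace

variable {b : ℝ}

lemma laplace_of_pos (hb : 0 < b) : laplace b =
    volume.withDensity (fun x => ENNReal.ofReal (1 / (2 * b) * Real.exp (-|x| / b))) :=
  if_pos hb

lemma laplace_of_nonpos (hb : b ≤ 0) : laplace b = Measure.dirac 0 :=
  if_neg hb.not_gt

lemma lintegral_laplace_density (hb : 0 < b) :
    ∫⁻ x, ENNReal.ofReal (1 / (2 * b) * Real.exp (-|x| / b)) = 1 := by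
  have hint : ∫ x : ℝ, 1 / (2 * b) * Real.exp (-|x| / b) = 1 := by
    have hexp : ∀ x : ℝ, Real.exp (-x / b) = Real.exp (-b⁻¹ * x) := fun x => by
      congr 1; field_simp
    rw [integral_comp_abs (f := fun x => 1 / (2 * b) * Real.exp (-x / b)), integral_const_mul]
    simp_rw [hexp]
    rw [integral_exp_mul_Ioi (by simpa using hb), mul_zero, Real.exp_zero]
    field_simp
  have hintegrable : Integrable fun x : ℝ => 1 / (2 * b) * Real.exp (-|x| / b) :=
    not_imp_comm.1 integral_undef (by rw [hint]; exact one_ne_zero)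
  rw [← ofReal_integral_eq_lintegral_ofReal hintegrable
    (Filter.Eventually.of_forall fun x => by positivity), hint, ENNReal.ofReal_one]

instance isProbabilityMeasure_laplace (b : ℝ) : IsProbabilityMeasure (laplace b) := by
  rcases lt_or_ge 0 b with hb | hb
  · rw [laplace_of_pos hb]
    exact ⟨by rw [withDensity_apply _ MeasurableSet.univ, Measure.restrict_univ,
      lintegral_laplace_density hb]⟩
  · rw [laplace_of_nonpos hb]
    infer_instance

lemma lintegral_exp_abs_laplace (hb : 0 < b) :
    ∫⁻ x, ENNReal.ofReal (Real.exp (|x| / (2 * b))) ∂(laplace b) = 2 := by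
  have hdensity : ∀ x : ℝ, ENNReal.ofReal (1 / (2 * b) * Real.exp (-|x| / b))
        * ENNReal.ofReal (Real.exp (|x| / (2 * b)))
      = 2 * ENNReal.ofReal (1 / (2 * (2 * b)) * Real.exp (-|x| / (2 * b))) := fun x => by
    have hexp : -|x| / b + |x| / (2 * b) = -|x| / (2 * b) := by field_simp; ring
    rw [← ENNReal.ofReal_mul (by positivity), ← ENNReal.ofReal_ofNat,
      ← ENNReal.ofReal_mul zero_le_two, mul_assoc, ← Real.exp_add, hexp]
    congr 1
    field_simp
  rw [laplace_of_pos hb, lintegral_withDensity_eq_lintegral_mul _ (by fun_prop) (by fun_prop)]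
  simp_rw [Pi.mul_apply, hdensity]
  rw [lintegral_const_mul _ (by fun_prop), lintegral_laplace_density (by positivity), mul_one]

lemma map_add_laplace (hb : 0 < b) (a : ℝ) : (laplace b).map (· + a) =
    volume.withDensity (fun x => ENNReal.ofReal (1 / (2 * b) * Real.exp (-|x - a| / b))) := by
  ext s hs
  rw [Measure.map_apply (by fun_prop) hs, laplace_of_pos hb,
    withDensity_apply _ (hs.preimage (by fun_prop)), withDensity_apply _ hs,
    ← lintegral_indicator (hs.preimage (by fun_prop)), ← lintegral_indicator hs,
    ← lintegral_add_right_eq_self (s.indicator _) a]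
  congr 1 with x
  simp only [Set.indicator, Set.mem_preimage, add_sub_cancel_right]
  rfl

lemma isPrivacyLoss_laplace (hb : 0 < b) (a a' : ℝ) :
    IsPrivacyLoss (fun x => (|x - a'| - |x - a|) / b)
      ((laplace b).map (· + a)) ((laplace b).map (· + a')) where
  measurable := by fun_prop
  eq_withDensity := by
    rw [map_add_laplace hb, map_add_laplace hb, ← withDensity_mul _ (by fun_prop) (by fun_prop)]
    congr 1 with x
    rw [Pi.mul_apply, ← ENNReal.ofReal_mul (by positivity), mul_assoc, ← Real.exp_add]
    ring_nf

lemma abs_abs_sub_sub_abs_sub_div_le (hb : 0 < b) (a a' x : ℝ) :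
    |(|x - a'| - |x - a|) / b| ≤ |a - a'| / b := by
  rw [abs_div, abs_of_pos hb]
  exact div_le_div_of_nonneg_right (by simpa using abs_abs_sub_abs_le (x - a') (x - a)) hb.le

end Laplace

section LaplaceMechanism

variable {ι : Type*} [Fintype ι] {b ε δ : ℝ} {a a' : ι → ℝ}

/-- The Laplace mechanism: independent Laplace variables of scale `b`, centred at the `a i`. -/
noncomputable def laplacePi (b : ℝ) (a : ι → ℝ) : Measure (ι → ℝ) :=
  (Measure.pi fun _ => laplace b).map (· + a)

instance isProbabilityMeasure_map_add_laplace (b a : ℝ) :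
    IsProbabilityMeasure ((laplace b).map (· + a)) :=
  Measure.isProbabilityMeasure_map (by fun_prop)

instance isProbabilityMeasure_laplacePi (b : ℝ) (a : ι → ℝ) :
    IsProbabilityMeasure (laplacePi b a) :=
  Measure.isProbabilityMeasure_map (by fun_prop)

lemma laplacePi_eq_pi (b : ℝ) (a : ι → ℝ) :
    laplacePi b a = Measure.pi fun i => (laplace b).map (· + a i) := by
  rw [← Measure.pi_map_pi fun i => by fun_prop]
  rfl

lemma indist_laplacePi (hb : 0 ≤ b) (hε : 0 ≤ ε) (h : ∑ i, |a i - a' i| ≤ b * ε) :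
    Indist ε 0 (laplacePi b a) (laplacePi b a') := by
  rcases hb.eq_or_lt with rfl | hb
  · rw [zero_mul] at h
    have haa' : a = a' := funext fun i => sub_eq_zero.1 <| abs_nonpos_iff.1 <|
      (Finset.single_le_sum (f := fun i => |a i - a' i|) (fun _ _ => abs_nonneg _)
        (Finset.mem_univ i)).trans h
    exact haa' ▸ Indist.refl hε _
  rw [laplacePi_eq_pi, laplacePi_eq_pi]
  have hpi := IsPrivacyLoss.pi fun i => isPrivacyLoss_laplace hb (a i) (a' i)
  refine hpi.indist_of_measure_lt_le ?_
  have hloss (x : ι → ℝ) : ∑ i, (|x i - a' i| - |x i - a i|) / b ≤ ε := by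
    calc ∑ i, (|x i - a' i| - |x i - a i|) / b ≤ ∑ i, |a i - a' i| / b := Finset.sum_le_sum
          fun i _ => (le_abs_self _).trans (abs_abs_sub_sub_abs_sub_div_le hb _ _ _)
      _ ≤ ε := by rw [← Finset.sum_div, div_le_iff₀ hb]; linarith
  simp [(hloss _).not_gt]

lemma indist_laplacePi_of_card (hε : 0 < ε) (hδ : 0 < δ) (hεδ : ε ≤ 8 * Real.log (1 / δ))
    (s : Finset ι) (hs : ∀ i ∉ s, a i = a' i) (h : ∀ i ∈ s, |a i - a' i| ≤ 1) :
    Indist ε δ (laplacePi (√(8 * s.card * Real.log (1 / δ)) / ε) a)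
      (laplacePi (√(8 * s.card * Real.log (1 / δ)) / ε) a') := by
  rcases s.eq_empty_or_nonempty with rfl | hne
  · have haa' : a = a' := funext fun i => hs i (Finset.notMem_empty i)
    exact haa' ▸ Indist.refl hε.le _
  set l := Real.log (1 / δ) with hl
  have hl_pos : 0 < l := by linarith
  set b := √(8 * s.card * l) / ε with hb
  have hb_pos : 0 < b := by positivity
  have hb_sq : s.card * (1 / b) ^ 2 = ε ^ 2 / (8 * l) := by
    rw [hb, one_div_div, div_pow, Real.sq_sqrt (by positivity)]
    field_simp
  have hcomp := IsPrivacyLoss.indist_pi (fun i => isPrivacyLoss_laplace hb_pos (a i) (a' i))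
    (c := (1 / b).toNNReal) s
    (fun i hi x => (abs_abs_sub_sub_abs_sub_div_le hb_pos _ _ x).trans
      ((div_le_div_of_nonneg_right (h i hi) hb_pos.le).trans (Real.le_coe_toNNReal _)))
    (fun i hi => funext fun x => by simp [hs i hi]) (half_pos hε).le
  rw [← laplacePi_eq_pi, ← laplacePi_eq_pi, Real.coe_toNNReal _ (by positivity), hb_sq] at hcomp
  have hδ_eq : Real.exp (-(ε / 2) ^ 2 / (2 * (ε ^ 2 / (8 * l)))) = δ := by
    have hexponent : -(ε / 2) ^ 2 / (2 * (ε ^ 2 / (8 * l))) = Real.log δ := by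
      rw [← neg_neg (Real.log δ), ← Real.log_inv, ← one_div, ← hl]
      field_simp
      norm_num
    rw [hexponent, Real.exp_log hδ]
  rw [hδ_eq] at hcomp
  refine hcomp.mono ?_
  have hmean : ε ^ 2 / (8 * l) / 2 ≤ ε / 2 := by
    gcongr
    rw [div_le_iff₀ (by positivity)]
    nlinarith
  linarith

end LaplaceMechanism

section LaplaceTail

variable {ι : Type*} [Fintype ι] {b : ℝ}

lemma measure_sum_abs_gt_le {t : ℝ} (hb : 0 < b) (J : Finset ι) :
    Measure.pi (fun _ : ι => laplace b) {x | t < ∑ j ∈ J, |x j|}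
      ≤ ENNReal.ofReal (2 ^ J.card * Real.exp (-t / (2 * b))) := by
  have hint : ∫⁻ x : ι → ℝ, ENNReal.ofReal (Real.exp (-t / (2 * b)))
        * ∏ j ∈ J, ENNReal.ofReal (Real.exp (|x j| / (2 * b))) ∂(Measure.pi fun _ => laplace b)
      = ENNReal.ofReal (2 ^ J.card * Real.exp (-t / (2 * b))) := by
    rw [lintegral_const_mul _ (by fun_prop), lintegral_pi_prod (fun _ : ι => laplace b) J
      (f := fun _ y => ENNReal.ofReal (Real.exp (|y| / (2 * b)))) (fun _ => by fun_prop)]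
    simp_rw [lintegral_exp_abs_laplace hb]
    rw [Finset.prod_const, mul_comm, ENNReal.ofReal_mul (by positivity),
      ENNReal.ofReal_pow zero_le_two, ENNReal.ofReal_ofNat]
  rw [← hint]
  refine meas_le_lintegral₀ (Measurable.aemeasurable (by fun_prop)) fun x hx => ?_
  rw [Set.mem_ofPred_eq] at hx
  rw [← ENNReal.ofReal_prod_of_nonneg fun _ _ => (Real.exp_pos _).le,
    ← ENNReal.ofReal_mul (Real.exp_pos _).le, ← Real.exp_sum, ← Real.exp_add, ← Finset.sum_div,
    ← add_div, ENNReal.one_le_ofReal]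
  exact Real.one_le_exp (div_nonneg (by linarith) (by linarith))

/-- The value that, with probability at least `1 - γ`, none of `A` sums of `m` absolute values of
Laplace variables of scale `b` exceeds. -/
noncomputable def tailBound (b γ : ℝ) (A m : ℕ) : ℝ := 2 * b * (Real.log (A / γ) + m)

lemma tailBound_eq {γ : ℝ} {A : ℕ} (hA : A ≠ 0) (hγ : γ ≠ 0) (b : ℝ) (m : ℕ) :
    tailBound b γ A m = 2 * b * (Real.log A + Real.log (1 / γ) + m) := by
  rw [tailBound, div_eq_mul_one_div, Real.log_mul (Nat.cast_ne_zero.2 hA) (one_div_ne_zero hγ)]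

lemma measure_tailBound_lt_sum_abs_le {γ : ℝ} (hb : 0 ≤ b) (hγ : 0 < γ) (J : Finset ι) {m : ℕ}
    (hJ : J.card ≤ m) :
    Measure.pi (fun _ : ι => laplace b) {x | tailBound b γ 1 m < ∑ j ∈ J, |x j|}
      ≤ ENNReal.ofReal γ := by
  rcases hb.eq_or_lt with rfl | hb
  · have hzero : ∀ᵐ x ∂Measure.pi (fun _ : ι => laplace 0), ∀ j, x j = 0 := by
      have hdirac : ∀ᵐ y ∂laplace 0, y = 0 := by
        rw [laplace_of_nonpos le_rfl, ae_dirac_eq]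
        exact rfl
      exact ae_all_iff.2 fun j =>
        (measurePreserving_eval (fun _ : ι => laplace 0) j).quasiMeasurePreserving.ae hdirac
    refine (measure_mono_null (fun x hx hx_zero => ?_) hzero).le.trans zero_le
    have hsum : ∑ j ∈ J, |x j| = 0 := Finset.sum_eq_zero fun j _ => by rw [hx_zero j, abs_zero]
    simp [tailBound, hsum] at hx
  refine (measure_sum_abs_gt_le hb J).trans (ENNReal.ofReal_le_ofReal ?_)
  have hexp : Real.exp (-tailBound b γ 1 m / (2 * b)) = γ * Real.exp (-m) := by
    have hexponent : -tailBound b γ 1 m / (2 * b) = Real.log γ + -m := by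
      rw [tailBound_eq one_ne_zero hγ.ne', Nat.cast_one, Real.log_one, one_div, Real.log_inv]
      field_simp
      ring
    rw [hexponent, Real.exp_add, Real.exp_log hγ]
  have hpow : (2 : ℝ) ^ J.card ≤ Real.exp m := by
    calc (2 : ℝ) ^ J.card ≤ 2 ^ m := pow_le_pow_right₀ one_le_two hJ
      _ ≤ Real.exp 1 ^ m := by gcongr; linarith [Real.add_one_le_exp 1]
      _ = Real.exp m := by rw [← Real.exp_nat_mul, mul_one]
  calc (2 : ℝ) ^ J.card * Real.exp (-tailBound b γ 1 m / (2 * b))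
      ≤ Real.exp m * (γ * Real.exp (-m)) := by rw [hexp]; gcongr
    _ = γ := by rw [Real.exp_neg]; field_simp

lemma measure_exists_lt_sum_abs_le {κ : Type*} {γ t : ℝ} (hb : 0 ≤ b) (hγ : 0 < γ) (A : Finset κ)
    (J : κ → Finset ι) {m : ℕ} (hJ : ∀ a ∈ A, (J a).card ≤ m)
    (ht : A.Nonempty → tailBound b γ A.card m ≤ t) :
    Measure.pi (fun _ : ι => laplace b) {x | ∃ a ∈ A, t < ∑ j ∈ J a, |x j|}
      ≤ ENNReal.ofReal γ := by
  rcases A.eq_empty_or_nonempty with rfl | hA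
  · simp
  have hA_pos : 0 < (A.card : ℝ) := Nat.cast_pos.2 hA.card_pos
  have hbound : tailBound b (γ / A.card) 1 m = tailBound b γ A.card m := by
    simp [tailBound]
  have hunion : {x : ι → ℝ | ∃ a ∈ A, t < ∑ j ∈ J a, |x j|}
      ⊆ ⋃ a ∈ A, {x | tailBound b (γ / A.card) 1 m < ∑ j ∈ J a, |x j|} := by
    rintro x ⟨a, ha, hx⟩
    exact Set.mem_biUnion ha ((hbound.trans_le (ht hA)).trans_lt hx)
  calc _ ≤ _ := (measure_mono hunion).trans (measure_biUnion_finset_le _ _)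
    _ ≤ ∑ _ ∈ A, ENNReal.ofReal (γ / A.card) := Finset.sum_le_sum fun a ha =>
        measure_tailBound_lt_sum_abs_le hb (div_pos hγ hA_pos) (J a) (hJ a ha)
    _ = ENNReal.ofReal γ := by
        rw [Finset.sum_const, nsmul_eq_mul, ← ENNReal.ofReal_natCast,
          ← ENNReal.ofReal_mul hA_pos.le, mul_div_cancel₀ _ hA_pos.ne']

lemma ofReal_one_sub_le_measure_forall_sum_abs_le {κ : Type*} {γ t : ℝ} (hb : 0 ≤ b) (hγ : 0 < γ)
    (A : Finset κ) (J : κ → Finset ι) {m : ℕ} (hJ : ∀ a ∈ A, (J a).card ≤ m)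
    (ht : A.Nonempty → tailBound b γ A.card m ≤ t) :
    ENNReal.ofReal (1 - γ)
      ≤ Measure.pi (fun _ : ι => laplace b) {x | ∀ a ∈ A, ∑ j ∈ J a, |x j| ≤ t} := by
  have hcompl : {x : ι → ℝ | ∀ a ∈ A, ∑ j ∈ J a, |x j| ≤ t}ᶜ
      = {x | ∃ a ∈ A, t < ∑ j ∈ J a, |x j|} := by
    ext x; simp
  rw [ENNReal.ofReal_sub _ hγ.le, ENNReal.ofReal_one, tsub_le_iff_right]
  calc (1 : ℝ≥0∞) = Measure.pi (fun _ : ι => laplace b) Set.univ := measure_univ.symm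
    _ ≤ _ := measure_univ_le_add_compl _
    _ ≤ _ := add_le_add_right (hcompl ▸ measure_exists_lt_sum_abs_le hb hγ A J hJ ht) _

end LaplaceTail

section Privacy

lemma measurable_rootedDist {W : Type u} (H : SimpleGraph W)
    (w : Sym2 W → ℝ≥0) (fuel : ℕ) (T : Finset W) (r x : W) :
    Measurable fun X : Finset W × W → ℝ => rootedDist H w X fuel T r x := by
  induction fuel generalizing T r with
  | zero => exact measurable_const
  | succ fuel ih =>
    simp only [rootedDist]
    split_ifs with hT hc
    · exact measurable_const
    · have := ih (desc H T hc.choose) hc.choose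
      fun_prop
    · exact ih _ _

lemma measurable_forestDist {W : Type u} [Fintype W] [DecidableEq W] (H : SimpleGraph W)
    (w : Sym2 W → ℝ≥0) (x y : W) :
    Measurable fun X : Finset W × W → ℝ => forestDist H w X x y := by
  have hroot (z : W) : Measurable fun X : Finset W × W → ℝ => rootDist H w X z :=
    measurable_rootedDist _ _ _ _ _ _
  unfold forestDist
  split_ifs
  · exact measurable_coe_real_ereal.comp
      (((hroot x).add (hroot y)).sub ((hroot _).const_mul 2))
  · exact measurable_const

variable {V : Type u} [Fintype V] [DecidableEq V] (G : SimpleGraph V) (S : Finset V)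

lemma measurable_releasedDist (w : Sym2 V → ℝ≥0) :
    Measurable fun X : Noise S => releasedDist G S w X := by
  have htree u v : Measurable fun X : Noise S => treeStep G S w X u v :=
    (measurable_forestDist _ _ u v).comp measurable_fst
  have hinner u v : Measurable fun X : Noise S => (innerStep G S w X u v : EReal) := by
    refine measurable_coe_real_ereal.comp ?_
    unfold innerStep
    fun_prop
  have hedge p v : Measurable fun X : Noise S => (noisyWeight S w X p v : EReal) := by
    refine measurable_coe_real_ereal.comp ?_
    unfold noisyWeight
    fun_prop
  have hlast u v : Measurable fun X : Noise S => lastStep G S w X u v :=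
    Measurable.iInf fun p => (htree u p).add (hedge p v)
  have hcross u v : Measurable fun X : Noise S => crossStep G S w X u v :=
    Measurable.iInf fun p => (hlast u p).add (hinner p v)
  have houter u v : Measurable fun X : Noise S => outerStep G S w X u v :=
    (htree u v).min (Measurable.iInf fun p => (hcross u p).add (hcross v p))
  refine measurable_pi_lambda _ fun u => measurable_pi_lambda _ fun v => ?_
  unfold releasedDist
  split_ifs with hu hv hv
  exacts [hinner u v, hcross ⟨v, hv⟩ u, hcross ⟨u, hu⟩ v, houter ⟨u, hu⟩ ⟨v, hv⟩]

/-- The quantities to which the algorithm adds noise. They vanish at the indices whose noise is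
never used, so that they depend on the weights of the edges of `G` only. -/
noncomputable def trueValues (w : Sym2 V → ℝ≥0) : Noise S :=
  open Classical in
  (forestQuery (G.induce {v | v ∉ S}) (fun e => w (e.map Subtype.val)),
    fun p => if p ∈ S ×ˢ S then wdist G w p.1 p.2 else 0,
    fun e => if e ∈ G.edgeSet then w e else 0)

lemma releasedDist_eq_releasedDist_zero (w : Sym2 V → ℝ≥0) (X : Noise S) :
    releasedDist G S w X = releasedDist G S 0 (X + trueValues G S w) := by
  have htree u v : treeStep G S w X u v = treeStep G S 0 (X + trueValues G S w) u v :=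
    forestDist_eq_forestDist_zero _ _ u v
  have hinner u (hu : u ∈ S) v (hv : v ∈ S) :
      innerStep G S w X u v = innerStep G S 0 (X + trueValues G S w) u v := by
    simp [innerStep, trueValues, wdist_zero, hu, hv, add_comm]
  have hlast u v : lastStep G S w X u v = lastStep G S 0 (X + trueValues G S w) u v := by
    refine iInf_congr fun p => ?_
    have hedge : noisyWeight S w X p v = noisyWeight S 0 (X + trueValues G S w) p v := by
      simp [noisyWeight, trueValues, p.2, add_comm]
    rw [htree, hedge]
  have hcross u v (hv : v ∈ S) :
      crossStep G S w X u v = crossStep G S 0 (X + trueValues G S w) u v :=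
    iInf_congr fun p => by rw [hlast, hinner p p.2 v hv]
  have houter u v : outerStep G S w X u v = outerStep G S 0 (X + trueValues G S w) u v := by
    unfold outerStep
    rw [htree, iInf_congr fun p : {p // p ∈ S} => by rw [hcross u p p.2, hcross v p p.2]]
  funext u v
  unfold releasedDist
  split_ifs with hu hv hv
  exacts [by rw [hinner u hu v hv], hcross _ u hu, hcross _ v hv, houter _ _]

lemma releaseLaw_eq_map_laplacePi (w : Sym2 V → ℝ≥0) (ε δ : ℝ) :
    releaseLaw G S w ε δ =
      ((laplacePi ((Nat.clog 2 (Fintype.card {v // v ∉ S}) : ℝ) / (ε / 3))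
          (trueValues G S w).1).prod
        ((laplacePi (2 * √2 * (S.card : ℝ) * √(Real.log (1 / δ)) / (ε / 3))
            (trueValues G S w).2.1).prod
          (laplacePi (1 / (ε / 3)) (trueValues G S w).2.2))).map
        (releasedDist G S 0) := by
  unfold laplacePi
  rw [Measure.map_prod_map _ _ (by fun_prop) (by fun_prop),
    Measure.map_prod_map _ _ (by fun_prop) (by fun_prop),
    Measure.map_map (measurable_releasedDist G S 0) (by fun_prop)]
  unfold releaseLaw noiseLaw forestNoise
  congr 1
  funext X
  exact releasedDist_eq_releasedDist_zero G S w X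

variable {G S} {w w' : Sym2 V → ℝ≥0} {ε δ : ℝ}

lemma indist_trueValues_tree (hS : IsFeedbackVertexSet G S) (h : Neighboring G w w')
    (hε : 0 < ε) :
    Indist ε 0 (laplacePi ((Nat.clog 2 (Fintype.card {v // v ∉ S}) : ℝ) / ε) (trueValues G S w).1)
      (laplacePi ((Nat.clog 2 (Fintype.card {v // v ∉ S}) : ℝ) / ε) (trueValues G S w').1) := by
  refine indist_laplacePi (by positivity) hε.le ?_
  rw [div_mul_cancel₀ _ hε.ne']
  refine (sum_abs_forestQuery_sub_le hS _ _).trans ?_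
  refine mul_le_of_le_one_right (Nat.cast_nonneg _) (le_trans ?_ h.weightChange_le_one)
  exact weightChange_induce_le w w' {v | v ∉ S} Finset.univ

lemma indist_trueValues_edge (h : Neighboring G w w') (hε : 0 < ε) :
    Indist ε 0 (laplacePi (1 / ε) (trueValues G S w).2.2)
      (laplacePi (1 / ε) (trueValues G S w').2.2) := by
  classical
  refine indist_laplacePi (by positivity) hε.le ?_
  rw [div_mul_cancel₀ _ hε.ne']
  refine le_trans (le_of_eq ?_) h
  rw [Finset.sum_filter]
  refine Finset.sum_congr rfl fun e _ => ?_
  by_cases he : e ∈ G.edgeSet <;> simp [trueValues, he]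

lemma indist_trueValues_inner (hG : G.Connected) (h : Neighboring G w w') (hε : 0 < ε)
    (hδ : 0 < δ) (hεδ : ε ≤ 8 * Real.log (1 / δ)) :
    Indist ε δ
      (laplacePi (2 * √2 * (S.card : ℝ) * √(Real.log (1 / δ)) / ε) (trueValues G S w).2.1)
      (laplacePi (2 * √2 * (S.card : ℝ) * √(Real.log (1 / δ)) / ε) (trueValues G S w').2.1) := by
  have hscale : 2 * √2 * (S.card : ℝ) * √(Real.log (1 / δ))
      = √(8 * (S ×ˢ S).card * Real.log (1 / δ)) := by
    have hl : 0 ≤ Real.log (1 / δ) := by linarith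
    rw [eq_comm, Real.sqrt_eq_iff_mul_self_eq (by positivity) (by positivity),
      Finset.card_product]
    push_cast
    linear_combination -4 * (S.card : ℝ) ^ 2 * Real.log (1 / δ) * Real.mul_self_sqrt zero_le_two
      - 4 * (S.card : ℝ) ^ 2 * (√2 * √2) * Real.mul_self_sqrt hl
  rw [hscale]
  refine indist_laplacePi_of_card hε hδ hεδ (S ×ˢ S) (fun p hp => ?_) fun p hp => ?_
  · simp only [trueValues, if_neg hp]
  · simp only [trueValues, if_pos hp]
    exact (abs_wdist_sub_le w w' (hG p.1 p.2)).trans h.weightChange_le_one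

lemma isDP_releaseLaw (hG : G.Connected) (hS : IsFeedbackVertexSet G S) (hε : 0 < ε)
    (hδ : 0 < δ) (hεδ : ε / 3 ≤ 8 * Real.log (1 / δ)) :
    IsDP (Neighboring G) (fun w => releaseLaw G S w ε δ) ε δ := by
  intro w w' h
  have hε' : 0 < ε / 3 := by positivity
  have hprod := (indist_trueValues_tree hS h hε').prod
    ((indist_trueValues_inner (S := S) hG h hε' hδ hεδ).prod_symm
      (indist_trueValues_edge (S := S) h hε'))
  have hmap := hprod.map (measurable_releasedDist G S 0)
  rwa [← releaseLaw_eq_map_laplacePi, ← releaseLaw_eq_map_laplacePi, ← add_assoc, add_thirds]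
    at hmap

end Privacy

section SmallNoise

variable {V : Type u} [Fintype V] [DecidableEq V] {G : SimpleGraph V} {S : Finset V}
  {w : Sym2 V → ℝ≥0} {X : Noise S} {E₁ E₂ E₃ : ℝ}

lemma coe_le_add_of_le_add {a b c : ℝ} {x y : EReal} (hx : (a : EReal) ≤ x)
    (hy : (b : EReal) ≤ y) (h : c ≤ a + b) : (c : EReal) ≤ x + y :=
  (EReal.coe_le_coe_iff.2 h).trans (by rw [EReal.coe_add]; exact add_le_add hx hy)

lemma add_le_coe_of_add_le {a b c : ℝ} {x y : EReal} (hx : x ≤ (a : EReal))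
    (hy : y ≤ (b : EReal)) (h : a + b ≤ c) : x + y ≤ (c : EReal) :=
  le_trans (by rw [EReal.coe_add]; exact add_le_add hx hy) (EReal.coe_le_coe_iff.2 h)

/-- The noise is bounded wherever it enters the released distances: by `E₁` along the recursion of
the forest mechanism towards any vertex, by `E₂` on the pairs of vertices of `S`, and by `E₃` on the
edges between `S` and its complement. -/
structure SmallNoise (G : SimpleGraph V) (S : Finset V) (X : Noise S) (E₁ E₂ E₃ : ℝ) : Prop where
  tree : ∀ x, ∑ j ∈ rootNoiseIndices (G.induce {v | v ∉ S}) x, |X.1 j| ≤ E₁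
  inner : ∀ u ∈ S, ∀ v ∈ S, |X.2.1 (u, v)| ≤ E₂
  edge : ∀ p ∉ S, ∀ v ∈ S, |X.2.2 s(p, v)| ≤ E₃

lemma exists_treeStep_eq (hS : IsFeedbackVertexSet G S) (hX : SmallNoise G S X E₁ E₂ E₃)
    {u v : {v // v ∉ S}} (h : (G.induce {v | v ∉ S}).Reachable u v) : ∃ e : ℝ, |e| ≤ 4 * E₁ ∧
      treeStep G S w X u v = ((wdist (G.induce {v | v ∉ S})
        (fun e => w (e.map Subtype.val)) u v + e : ℝ) : EReal) := by
  refine ⟨_, ?_, forestDist_of_reachable hS _ X.1 h⟩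
  have hroot x : |∑ j ∈ rootNoiseIndices (G.induce {v | v ∉ S}) x, X.1 j| ≤ E₁ :=
    (Finset.abs_sum_le_sum_abs _ _).trans (hX.tree x)
  have hu := abs_le.1 (hroot u)
  have hv := abs_le.1 (hroot v)
  have hlca := abs_le.1 (hroot (lca (G.induce {v | v ∉ S}) u v))
  rw [abs_le]
  constructor <;> linarith

lemma le_treeStep (hS : IsFeedbackVertexSet G S) (hX : SmallNoise G S X E₁ E₂ E₃)
    (u v : {v // v ∉ S}) : ((wdist G w u v - 4 * E₁ : ℝ) : EReal) ≤ treeStep G S w X u v := by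
  by_cases h : (G.induce {v | v ∉ S}).Reachable u v
  · obtain ⟨e, he, htree⟩ := exists_treeStep_eq (w := w) hS hX h
    obtain ⟨p, -, hp⟩ := exists_isPath_walkWeight_eq_wdist (fun e => w (e.map Subtype.val)) h
    rw [htree, EReal.coe_le_coe_iff, ← hp]
    linarith [wdist_le_walkWeight_induce w p, (abs_le.1 he).1]
  · exact le_top.trans_eq (forestDist_of_not_reachable _ _ h).symm

lemma treeStep_le (hS : IsFeedbackVertexSet G S) (hX : SmallNoise G S X E₁ E₂ E₃)
    {u v : {v // v ∉ S}} (p : (G.induce {v | v ∉ S}).Walk u v) : treeStep G S w X u v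
      ≤ ((walkWeight (fun e => w (e.map Subtype.val)) p + 4 * E₁ : ℝ) : EReal) := by
  obtain ⟨e, he, htree⟩ := exists_treeStep_eq (w := w) hS hX ⟨p⟩
  rw [htree, EReal.coe_le_coe_iff]
  linarith [wdist_le_walkWeight (fun e => w (e.map Subtype.val)) p, (abs_le.1 he).2]

lemma le_lastStep (hG : G.Connected) (hS : IsFeedbackVertexSet G S)
    (hX : SmallNoise G S X E₁ E₂ E₃) (u : {v // v ∉ S}) {v : V} (hv : v ∈ S) :
    ((wdist G w u v - (4 * E₁ + E₃) : ℝ) : EReal) ≤ lastStep G S w X u v := by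
  refine le_iInf fun p => coe_le_add_of_le_add (le_treeStep hS hX u p) le_rfl ?_
  rw [noisyWeight]
  linarith [wdist_triangle w (hG u p) (hG p v), wdist_le_of_adj w p.2,
    (abs_le.1 (hX.edge p p.1.2 v hv)).1]

lemma lastStep_le (hS : IsFeedbackVertexSet G S) (hX : SmallNoise G S X E₁ E₂ E₃)
    {u q : {v // v ∉ S}} {v : V} (hv : v ∈ S) (hq : G.Adj q v)
    (p : (G.induce {v | v ∉ S}).Walk u q) : lastStep G S w X u v
      ≤ ((walkWeight (fun e => w (e.map Subtype.val)) p + w s((q : V), v)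
        + (4 * E₁ + E₃) : ℝ) : EReal) := by
  refine (iInf_le _ ⟨q, hq⟩).trans (add_le_coe_of_add_le (treeStep_le hS hX p) le_rfl ?_)
  rw [noisyWeight]
  linarith [(abs_le.1 (hX.edge q q.2 v hv)).2]

lemma le_crossStep (hG : G.Connected) (hS : IsFeedbackVertexSet G S)
    (hX : SmallNoise G S X E₁ E₂ E₃) (u : {v // v ∉ S}) {v : V} (hv : v ∈ S) :
    ((wdist G w u v - (4 * E₁ + E₂ + E₃) : ℝ) : EReal) ≤ crossStep G S w X u v := by
  refine le_iInf fun p => coe_le_add_of_le_add (le_lastStep hG hS hX u p.2) le_rfl ?_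
  rw [innerStep]
  linarith [wdist_triangle w (hG u p) (hG p v), (abs_le.1 (hX.inner p p.2 v hv)).1]

lemma crossStep_le (hG : G.Connected) (hS : IsFeedbackVertexSet G S)
    (hX : SmallNoise G S X E₁ E₂ E₃) (u : {v // v ∉ S}) {v : V} (hv : v ∈ S) :
    crossStep G S w X u v ≤ ((wdist G w u v + (4 * E₁ + E₂ + E₃) : ℝ) : EReal) := by
  obtain ⟨P, -, hP⟩ := exists_isPath_walkWeight_eq_wdist w (hG u v)
  obtain ⟨hv', -⟩ | ⟨q, x, hx, hqx, p, R, hPR⟩ :=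
    walkWeight_eq_or_split (P := (· ∉ S)) w P u.2
  · exact absurd hv hv'
  rw [not_not] at hx
  refine (iInf_le _ ⟨x, hx⟩).trans (add_le_coe_of_add_le (lastStep_le hS hX hx hqx p) le_rfl ?_)
  rw [innerStep, ← hP, hPR]
  linarith [wdist_le_walkWeight w R, (abs_le.1 (hX.inner x hx v hv)).2]

lemma le_outerStep (hG : G.Connected) (hS : IsFeedbackVertexSet G S)
    (hX : SmallNoise G S X E₁ E₂ E₃) (hE : 0 ≤ 2 * E₁ + E₂ + E₃) (u v : {v // v ∉ S}) :
    ((wdist G w u v - 2 * (4 * E₁ + E₂ + E₃) : ℝ) : EReal) ≤ outerStep G S w X u v := by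
  refine le_min ((EReal.coe_le_coe_iff.2 (by linarith)).trans (le_treeStep hS hX u v)) ?_
  refine le_iInf fun p =>
    coe_le_add_of_le_add (le_crossStep hG hS hX u p.2) (le_crossStep hG hS hX v p.2) ?_
  rw [wdist_comm w v p]
  linarith [wdist_triangle w (hG u p) (hG p v)]

lemma outerStep_le (hG : G.Connected) (hS : IsFeedbackVertexSet G S)
    (hX : SmallNoise G S X E₁ E₂ E₃) (hE : 0 ≤ 2 * E₁ + E₂ + E₃) (u v : {v // v ∉ S}) :
    outerStep G S w X u v ≤ ((wdist G w u v + 2 * (4 * E₁ + E₂ + E₃) : ℝ) : EReal) := by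
  obtain ⟨P, -, hP⟩ := exists_isPath_walkWeight_eq_wdist w (hG u v)
  obtain ⟨hv, p, hp⟩ | ⟨q, x, hx, hqx, p, R, hPR⟩ :=
    walkWeight_eq_or_split (P := (· ∉ S)) w P u.2
  · refine (min_le_left _ _).trans ((treeStep_le hS hX p).trans ?_)
    rw [EReal.coe_le_coe_iff, ← hP, hp]
    linarith
  · rw [not_not] at hx
    refine (min_le_right _ _).trans ((iInf_le _ ⟨x, hx⟩).trans ?_)
    refine add_le_coe_of_add_le (crossStep_le hG hS hX u hx) (crossStep_le hG hS hX v hx) ?_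
    rw [wdist_comm w v x, ← hP, hPR]
    linarith [wdist_le_walkWeight w R, wdist_le_walkWeight_induce w p,
      wdist_triangle w (hG u q) (hG q x), wdist_le_of_adj w hqx]

theorem releasedDist_mem_Icc (hG : G.Connected) (hS : IsFeedbackVertexSet G S)
    (hX : SmallNoise G S X E₁ E₂ E₃) (h₁ : 0 ≤ E₁) (h₂ : 0 ≤ E₂) (h₃ : 0 ≤ E₃) (u v : V) :
    releasedDist G S w X u v ∈ Set.Icc ((wdist G w u v - 2 * (4 * E₁ + E₂ + E₃) : ℝ) : EReal)
      ((wdist G w u v + 2 * (4 * E₁ + E₂ + E₃) : ℝ) : EReal) := by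
  have hcross (u : {v // v ∉ S}) (v : V) (hv : v ∈ S) : crossStep G S w X u v ∈
      Set.Icc ((wdist G w u v - 2 * (4 * E₁ + E₂ + E₃) : ℝ) : EReal)
        ((wdist G w u v + 2 * (4 * E₁ + E₂ + E₃) : ℝ) : EReal) :=
    ⟨(EReal.coe_le_coe_iff.2 (by linarith)).trans (le_crossStep hG hS hX u hv),
      (crossStep_le hG hS hX u hv).trans (EReal.coe_le_coe_iff.2 (by linarith))⟩
  unfold releasedDist
  split_ifs with hu hv hv
  · obtain ⟨hle, hge⟩ := abs_le.1 (hX.inner u hu v hv)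
    rw [innerStep, Set.mem_Icc, EReal.coe_le_coe_iff, EReal.coe_le_coe_iff]
    constructor <;> linarith
  · rw [wdist_comm]
    exact hcross ⟨v, hv⟩ u hu
  · exact hcross ⟨u, hu⟩ v hv
  · exact ⟨le_outerStep hG hS hX (by linarith) ⟨u, hu⟩ ⟨v, hv⟩,
      outerStep_le hG hS hX (by linarith) ⟨u, hu⟩ ⟨v, hv⟩⟩

end SmallNoise

section ErrorBounds

variable {n : ℕ} {ε γ : ℝ}

lemma clog_two_le_three_mul_log (hn : 2 ≤ n) : (Nat.clog 2 n : ℝ) ≤ 3 * Real.log n := by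
  have hpow : 2 ^ (Nat.clog 2 n).pred < n := Nat.pow_pred_clog_lt_self one_lt_two hn
  have hpred : ((Nat.clog 2 n).pred : ℝ) * Real.log 2 ≤ Real.log n := by
    rw [← Real.log_pow]
    exact Real.log_le_log (by positivity) (by exact_mod_cast hpow.le)
  have hclog : (Nat.clog 2 n : ℝ) = ((Nat.clog 2 n).pred : ℝ) + 1 := by
    exact_mod_cast (Nat.succ_pred_eq_of_pos (Nat.clog_pos one_lt_two hn)).symm
  have hlog : Real.log 2 ≤ Real.log n := Real.log_le_log (by norm_num) (by exact_mod_cast hn)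
  rw [hclog]
  nlinarith [Real.log_two_gt_d9, ((Nat.clog 2 n).pred).cast_nonneg (α := ℝ)]

lemma one_le_log_one_div (hγ : 0 < γ) (hγ' : 3 * γ < 1) : 1 ≤ Real.log (1 / γ) := by
  rw [Real.le_log_iff_exp_le (by positivity), le_div_iff₀ hγ]
  nlinarith [Real.exp_one_lt_d9]

lemma sq_le_two_mul_rpow {l : ℝ} (hl : 1 / 4 ≤ l) : l ^ 2 ≤ 2 * l ^ (5 / 2 : ℝ) := by
  have hl_pos : 0 < l := by linarith
  have hrpow : l ^ (5 / 2 : ℝ) = l ^ 2 * √l := by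
    rw [Real.sqrt_eq_rpow, ← Real.rpow_natCast, ← Real.rpow_add hl_pos]
    norm_num
  have hsqrt : 1 / 2 ≤ √l := Real.le_sqrt_of_sq_le (by norm_num; linarith)
  rw [hrpow]
  nlinarith [sq_nonneg l]

lemma tailBound_forest_le {N : ℕ} (hNn : N ≤ n) (hε : 0 < ε) (hγ : 0 < γ) (hγ' : 3 * γ < 1) :
    tailBound ((Nat.clog 2 N : ℝ) / (ε / 3)) γ N (2 * Nat.clog 2 N)
      ≤ 306 * (ε⁻¹ * Real.log n ^ (5 / 2 : ℝ) * Real.log (1 / γ)) := by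
  have hg := one_le_log_one_div hγ hγ'
  rcases Nat.lt_or_ge N 2 with hN | hN
  · rw [tailBound, Nat.clog_of_right_le_one (by omega), Nat.cast_zero, zero_div, mul_zero,
      zero_mul]
    have := Real.log_natCast_nonneg n
    positivity
  have hlogN : Real.log N ≤ Real.log n :=
    Real.log_le_log (by positivity) (by exact_mod_cast hNn)
  have hlog2 : Real.log 2 ≤ Real.log n :=
    Real.log_le_log (by norm_num) (by exact_mod_cast hN.trans hNn)
  have hlog2_gt := Real.log_two_gt_d9
  have hclog : (Nat.clog 2 N : ℝ) ≤ 3 * Real.log n :=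
    (clog_two_le_three_mul_log hN).trans (by gcongr)
  have hsq := sq_le_two_mul_rpow (l := Real.log n) (by linarith)
  rw [tailBound_eq (by omega) hγ.ne', Nat.cast_mul, Nat.cast_ofNat]
  set l := Real.log n
  set g := Real.log (1 / γ)
  set c := (Nat.clog 2 N : ℝ)
  calc 2 * (c / (ε / 3)) * (Real.log N + g + 2 * c)
      = 6 * ε⁻¹ * (c * (Real.log N + g + 2 * c)) := by field_simp; ring
    _ ≤ 6 * ε⁻¹ * (3 * l * (8.5 * l * g)) := by
        have := Real.log_natCast_nonneg N
        gcongr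
        nlinarith
    _ = 153 * ε⁻¹ * g * l ^ 2 := by ring
    _ ≤ 153 * ε⁻¹ * g * (2 * l ^ (5 / 2 : ℝ)) := by gcongr
    _ = _ := by ring

lemma tailBound_edge_le {A : ℕ} (hA : A ≠ 0) (hn : 2 ≤ n) (hAn : A ≤ n ^ 2) (hε : 0 < ε)
    (hγ : 0 < γ) (hγ' : 3 * γ < 1) : tailBound (1 / (ε / 3)) γ A 1
      ≤ 90 * (ε⁻¹ * Real.log n ^ (5 / 2 : ℝ) * Real.log (1 / γ)) := by
  have hg := one_le_log_one_div hγ hγ'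
  have hlogA : Real.log A ≤ 2 * Real.log n := by
    have := Real.log_le_log (Nat.cast_pos.2 hA.bot_lt) (show (A : ℝ) ≤ (n : ℝ) ^ 2 by
      exact_mod_cast hAn)
    rwa [Real.log_pow] at this
  have hlog2 : Real.log 2 ≤ Real.log n := Real.log_le_log (by norm_num) (by exact_mod_cast hn)
  have hlog2_gt := Real.log_two_gt_d9
  have hsq := sq_le_two_mul_rpow (l := Real.log n) (by linarith)
  rw [tailBound_eq hA hγ.ne', Nat.cast_one]
  set l := Real.log n
  set g := Real.log (1 / γ)
  have hl_le : l ≤ 1.5 * l ^ 2 := by nlinarith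
  have hone_le : (1 : ℝ) ≤ 2.25 * l ^ 2 := by nlinarith
  calc 2 * (1 / (ε / 3)) * (Real.log A + g + 1)
      = 6 * ε⁻¹ * (Real.log A + g + 1) := by field_simp; ring
    _ ≤ 6 * ε⁻¹ * (7.5 * l ^ 2 * g) := by
        gcongr
        nlinarith [hl_le, hone_le]
    _ = 45 * ε⁻¹ * g * l ^ 2 := by ring
    _ ≤ 45 * ε⁻¹ * g * (2 * l ^ (5 / 2 : ℝ)) := by gcongr
    _ = _ := by ring

lemma tailBound_inner_le {k : ℕ} (hk : k ≠ 0) {r : ℝ} (hr : 0 ≤ r) (hε : 0 < ε) (hγ : 0 < γ)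
    (hγ' : 3 * γ < 1) : tailBound (2 * √2 * (k : ℝ) * r / (ε / 3)) γ (k * k) 1
      ≤ 72 * (ε⁻¹ * k * Real.log (k / γ) * r) := by
  have hg := one_le_log_one_div hγ hγ'
  have hk' : (k : ℝ) ≠ 0 := Nat.cast_ne_zero.2 hk
  have hlogk := Real.log_natCast_nonneg k
  rw [tailBound_eq (mul_ne_zero hk hk) hγ.ne', Nat.cast_mul, Real.log_mul hk' hk', Nat.cast_one,
    div_eq_mul_one_div (k : ℝ) γ, Real.log_mul hk' (one_div_ne_zero hγ.ne')]
  set g := Real.log (1 / γ)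
  have hsqrt : √2 ≤ 2 := Real.sqrt_le_iff.2 ⟨by norm_num, by norm_num⟩
  calc 2 * (2 * √2 * (k : ℝ) * r / (ε / 3)) * (Real.log k + Real.log k + g + 1)
      = 12 * ε⁻¹ * k * r * √2 * (2 * Real.log k + g + 1) := by field_simp; ring
    _ ≤ 12 * ε⁻¹ * k * r * 2 * (3 * (Real.log k + g)) := by
        gcongr
        linarith
    _ = _ := by ring

end ErrorBounds

section Accuracy

lemma ofReal_one_sub_three_mul_le_prod {α β ξ : Type*} [MeasurableSpace α] [MeasurableSpace β]
    [MeasurableSpace ξ] {μ : Measure α} {ν : Measure β} {ρ : Measure ξ} [SFinite ν] [SFinite ρ]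
    {s : Set α} {t : Set β} {u : Set ξ} {γ : ℝ} (hs : ENNReal.ofReal (1 - γ) ≤ μ s)
    (ht : ENNReal.ofReal (1 - γ) ≤ ν t) (hu : ENNReal.ofReal (1 - γ) ≤ ρ u) :
    ENNReal.ofReal (1 - 3 * γ) ≤ μ.prod (ν.prod ρ) (s ×ˢ t ×ˢ u) := by
  rcases le_total 1 (3 * γ) with hγ | hγ
  · rw [ENNReal.ofReal_of_nonpos (by linarith)]
    exact zero_le
  rw [Measure.prod_prod, Measure.prod_prod]
  calc ENNReal.ofReal (1 - 3 * γ) ≤ ENNReal.ofReal ((1 - γ) ^ 3) := by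
        refine ENNReal.ofReal_le_ofReal ?_
        have := one_add_mul_le_pow (a := -γ) (by linarith) 3
        push_cast at this
        linarith
    _ = ENNReal.ofReal (1 - γ) * (ENNReal.ofReal (1 - γ) * ENNReal.ofReal (1 - γ)) := by
        rw [ENNReal.ofReal_pow (by linarith)]; ring
    _ ≤ μ s * (ν t * ρ u) := by gcongr

variable {V : Type u} [Fintype V] [DecidableEq V] {G : SimpleGraph V} {S : Finset V} {ε γ : ℝ}

lemma measure_smallNoise_ge (hS : IsFeedbackVertexSet G S) {δ E₁ E₂ E₃ : ℝ} (hε : 0 < ε)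
    (hγ : 0 < γ)
    (h₁ : tailBound ((Nat.clog 2 (Fintype.card {v // v ∉ S}) : ℝ) / (ε / 3)) γ
      (Fintype.card {v // v ∉ S}) (2 * Nat.clog 2 (Fintype.card {v // v ∉ S})) ≤ E₁)
    (h₂ : (S ×ˢ S).Nonempty → tailBound
      (2 * √2 * (S.card : ℝ) * √(Real.log (1 / δ)) / (ε / 3)) γ (S ×ˢ S).card 1 ≤ E₂)
    (h₃ : (Sᶜ ×ˢ S).Nonempty → tailBound (1 / (ε / 3)) γ (Sᶜ ×ˢ S).card 1 ≤ E₃) :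
    ENNReal.ofReal (1 - 3 * γ) ≤ noiseLaw S ε δ {X | SmallNoise G S X E₁ E₂ E₃} := by
  have htree := ofReal_one_sub_le_measure_forall_sum_abs_le (by positivity) hγ Finset.univ
    (rootNoiseIndices (G.induce {v | v ∉ S})) (fun x _ => card_rootNoiseIndices_le hS x)
    (fun _ => h₁)
  have hinner := ofReal_one_sub_le_measure_forall_sum_abs_le (by positivity) hγ (S ×ˢ S)
    (fun p => {p}) (fun p _ => (Finset.card_singleton p).le) h₂
  have hedge := ofReal_one_sub_le_measure_forall_sum_abs_le (by positivity) hγ (Sᶜ ×ˢ S)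
    (fun p => {s(p.1, p.2)}) (fun _ _ => (Finset.card_singleton _).le) h₃
  refine (ofReal_one_sub_three_mul_le_prod htree hinner hedge).trans (measure_mono ?_)
  rintro X ⟨hX₁, hX₂, hX₃⟩
  exact ⟨fun x => hX₁ x (Finset.mem_univ x),
    fun u hu v hv => by simpa using hX₂ (u, v) (Finset.mk_mem_product hu hv),
    fun p hp v hv => by
      simpa using hX₃ (p, v) (Finset.mk_mem_product (Finset.mem_compl.2 hp) hv)⟩

lemma smallNoise_le_releaseLaw (hG : G.Connected) (hS : IsFeedbackVertexSet G S)
    (w : Sym2 V → ℝ≥0) {δ E₁ E₂ E₃ R : ℝ} (h₁ : 0 ≤ E₁) (h₂ : 0 ≤ E₂) (h₃ : 0 ≤ E₃)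
    (hR : 2 * (4 * E₁ + E₂ + E₃) ≤ R) :
    noiseLaw S ε δ {X | SmallNoise G S X E₁ E₂ E₃} ≤ releaseLaw G S w ε δ
      {D | ∀ u v : V, ((wdist G w u v - R : ℝ) : EReal) ≤ D u v ∧
        D u v ≤ ((wdist G w u v + R : ℝ) : EReal)} := by
  refine le_trans (measure_mono fun X hX => ?_)
    (Measure.le_map_apply (measurable_releasedDist G S w).aemeasurable _)
  intro u v
  obtain ⟨hle, hge⟩ := releasedDist_mem_Icc (w := w) hG hS hX h₁ h₂ h₃ u v
  exact ⟨(EReal.coe_le_coe_iff.2 (by linarith)).trans hle,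
    hge.trans (EReal.coe_le_coe_iff.2 (by linarith))⟩

theorem accuracy_releaseLaw (hG : G.Connected) (hS : IsFeedbackVertexSet G S) (hε : 0 < ε)
    (hγ : 0 < γ) (w : Sym2 V → ℝ≥0) (δ : ℝ) {R : ℝ}
    (hR : 3000 * (ε⁻¹ * S.card * Real.log (S.card / γ) * √(Real.log (1 / δ))
      + ε⁻¹ * Real.log (Fintype.card V) ^ (5 / 2 : ℝ) * Real.log (1 / γ)) ≤ R) :
    ENNReal.ofReal (1 - 3 * γ) ≤ releaseLaw G S w ε δ
      {D | ∀ u v : V, ((wdist G w u v - R : ℝ) : EReal) ≤ D u v ∧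
        D u v ≤ ((wdist G w u v + R : ℝ) : EReal)} := by
  rcases le_or_gt 1 (3 * γ) with hγ' | hγ'
  · rw [ENNReal.ofReal_of_nonpos (by linarith)]
    exact zero_le
  set U := ε⁻¹ * S.card * Real.log (S.card / γ) * √(Real.log (1 / δ)) with hU
  set T := ε⁻¹ * Real.log (Fintype.card V) ^ (5 / 2 : ℝ) * Real.log (1 / γ) with hT
  have hU_nonneg : 0 ≤ U := by
    rcases S.card.eq_zero_or_pos with h | h
    · simp [hU, h]
    · have hlog : 0 ≤ Real.log (S.card / γ) := Real.log_nonneg (by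
        rw [le_div_iff₀ hγ]; linarith [show (1 : ℝ) ≤ S.card from Nat.one_le_cast.2 h])
      positivity
  have hT_nonneg : 0 ≤ T := by
    have := Real.log_natCast_nonneg (Fintype.card V)
    have := one_le_log_one_div hγ hγ'
    positivity
  have hsmall := measure_smallNoise_ge hS hε hγ (E₁ := 306 * T) (E₂ := 72 * U) (E₃ := 90 * T)
    (tailBound_forest_le (Fintype.card_subtype_le _) hε hγ hγ')
    (fun hne => by
      rw [Finset.card_product]
      exact tailBound_inner_le hne.fst.card_pos.ne' (Real.sqrt_nonneg _) hε hγ hγ')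
    (fun hne => by
      refine tailBound_edge_le hne.card_pos.ne' ?_ ?_ hε hγ hγ'
      · obtain ⟨p, hp⟩ := hne
        rw [Finset.mem_product, Finset.mem_compl] at hp
        exact Fintype.one_lt_card_iff.2 ⟨p.1, p.2, fun h => hp.1 (h ▸ hp.2)⟩
      · rw [Finset.card_product, sq]
        exact Nat.mul_le_mul (Finset.card_le_univ _) (Finset.card_le_univ _))
  exact hsmall.trans (smallNoise_le_releaseLaw hG hS w (by positivity) (by positivity)
    (by positivity) (by linarith))

end Accuracy

end FVSRelease

theorem mainTheorem2 :
    ∃ C : ℝ, 0 < C ∧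
      ∀ (V : Type u) [Fintype V] [DecidableEq V] (G : SimpleGraph V) (_ : G.Connected)
        (S : Finset V) (_ : FVSRelease.IsFeedbackVertexSet G S)
        (ε δ : ℝ) (_ : 0 < ε) (_ : 0 < δ) (_ : δ < 1),
        (ε / 3 ≤ 8 * Real.log (1 / δ) →
          FVSRelease.IsDP (FVSRelease.Neighboring G)
            (fun w => FVSRelease.releaseLaw G S w ε δ) ε δ) ∧
        ∀ (w : Sym2 V → ℝ≥0) (γ : ℝ), 0 < γ →
          ENNReal.ofReal (1 - 3 * γ) ≤
            FVSRelease.releaseLaw G S w ε δ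
              {D | ∀ u v : V,
                ((FVSRelease.wdist G w u v
                  - C * (ε⁻¹ * S.card * Real.log (S.card / γ) * √(Real.log (1 / δ))
                    + ε⁻¹ * Real.log (Fintype.card V) ^ (5 / 2 : ℝ) * Real.log (1 / γ)) : ℝ)
                      : EReal) ≤ D u v ∧
                D u v ≤ ((FVSRelease.wdist G w u v
                  + C * (ε⁻¹ * S.card * Real.log (S.card / γ) * √(Real.log (1 / δ))
                    + ε⁻¹ * Real.log (Fintype.card V) ^ (5 / 2 : ℝ) * Real.log (1 / γ)) : ℝ)
                      : EReal)} := by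
  exact ⟨3000, by norm_num, fun V _ _ G hG S hS ε δ hε hδ _ =>
    ⟨FVSRelease.isDP_releaseLaw hG hS hε hδ,
      fun w γ hγ => FVSRelease.accuracy_releaseLaw hG hS hε hγ w δ le_rfl⟩⟩
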